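/- **Conventions.** A protocol in the shuffle model for $n$ parties consists of a local randomizer $R:X\to Y^k$ (randomized) and an analyzer $A:Y^{nk}\to O$. Each party $i$ applies $R$ independently to its input $x_i$; the resulting $nk$ messages are permuted by a uniformly random permutation, and this shuffled tuple (the view) is given to $A$. The protocol is $(\varepsilon,\delta)$-differentially private if for all inputs $x,x'\in X^n$ differing in one coordinate and every collection $T$ of multisets of messages, $P(\text{multiset of the view on } x\in T)\le e^{\varepsilon}P(\text{multiset of the view on } x'\in T)+\delta$. Its communication per party is $k\lceil\log_2|Y|\rceil$ bits. For real summation, $X=[0,1]$, $O=\mathbb R$, and $\mathrm{MSE}(x)=\mathbb E\big[(\text{output}-\sum_i x_i)^2\big]$. The Pólya$(r,\alpha)$ distribution on $\{0,1,2,\dots\}$ has mass $\frac{r(r+1)\cdots(r+k-1)}{k!}\alpha^k(1-\alpha)^r$ at $k$. **Protocol.** Let $n\ge 2$, $\varepsilon>0$, $0<\delta<1$, and put $$p=\lceil\sqrt n\,\rceil,\quad q=2np,\quad \alpha=e^{-\varepsilon/p},\quad k=2+5\lceil\log_2 q\rceil+2\lceil\log_2(1/\delta)+\log_2(n-1)\rceil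 .$$ On input $x\in[0,1]$ the local randomizer forms $\tilde x=\lfloor xp\rfloor+\mathrm{Ber}(xp-\lfloor xp\rfloor)$, adds the difference of two independent Pólya$(1/n,\alpha)$ variables to get $y\in\mathbb Z$, and outputs a uniformly random element of $(\mathbb Z/q)^k$ conditioned on its coordinates summing to $y$ modulo $q$. The analyzer adds all messages modulo $q$ to get $z\in\{0,\dots,q-1\}$, replaces $z$ by $z-q$ if $z>(np+q)/2$, and returns $z/p$. **Theorem.** For all $n\ge2$, $\varepsilon>0$, $0<\delta<1$, this is a protocol in the shuffle model for summing $n$ reals in $[0,1]$ for which the following hold. 1. (Privacy) It is $(\varepsilon,\delta)$-differentially private. 2. (Error) For every $\varepsilon$ there are $A,B$, not depending on $\delta$ and $n$, such that $\sup_x \mathrm{MSE}(x)\le B$ and $$\left|\ \sup_{x\in[0,1]^n}\mathrm{MSE}(x)-\left(\frac{2\alpha}{p^2(1-\alpha)^2}+\frac{n}{4p^2}\right)\right|\le A\,n^2e^{-\varepsilon n/2}.$$ 3. (Communication) It uses exactly $k\lceil\log_2 q\rceil$ bits per party, and for every $\delta$ there is $K$, not depending on $\varepsilon$ and $n$, such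 that this is at most $K(\log n)^2$. In particular there is an $(\varepsilon,\delta)$-differentially private protocol in the shuffle model for real summation with $O_{\varepsilon,\delta}(1)$ error and $O_{\varepsilon,\delta}(\log^2 n)$ bits of communication per party. -/

import Mathlib

open scoped ENNReal BigOperators

noncomputable section

namespace ShuffleSum

/-! ### Discrete distributions -/

theorem tsum_prod_pi {β : Type} : ∀ (n : ℕ) (f : Fin n → β → ℝ≥0∞),
    ∑' b : Fin n → β, ∏ i, f i (b i) = ∏ i, ∑' b, f i b
  | 0, f => by simp
  | n + 1, f => by
    rw [← (Fin.consEquiv (fun _ : Fin (n + 1) => β)).tsum_eq, ENNReal.tsum_prod',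
      Fin.prod_univ_succ, ← tsum_prod_pi n (fun i => f i.succ), ← ENNReal.tsum_mul_right]
    refine tsum_congr fun a => ?_
    rw [← ENNReal.tsum_mul_left]
    refine tsum_congr fun b => ?_
    rw [Fin.prod_univ_succ]
    simp [Fin.consEquiv]

/-- The joint law of independent random variables with laws `μ 0, …, μ (n - 1)`. -/
def indep {β : Type} {n : ℕ} (μ : Fin n → PMF β) : PMF (Fin n → β) :=
  ⟨fun b => ∏ i, μ i (b i), by
    have h := ENNReal.summable.hasSum (f := fun b : Fin n → β => ∏ i, μ i (b i))
    rw [tsum_prod_pi n (fun i b => μ i b)] at h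
    simpa using h⟩

/-- The probability mass `r (r + 1) ⋯ (r + k - 1) / k! * α ^ k * (1 - α) ^ r` that the
Pólya(`r`, `α`) distribution gives to `k`. -/
def polyaMass (r α : ℝ) (k : ℕ) : ℝ :=
  (ascPochhammer ℝ k).eval r / (k.factorial : ℝ) * α ^ k * (1 - α) ^ r

theorem polyaMass_nonneg {r α : ℝ} (hr : 0 < r) (h0 : 0 < α) (h1 : α < 1) (k : ℕ) :
    0 ≤ polyaMass r α k := by
  have h := ascPochhammer_pos k r hr
  have : 0 ≤ (1 - α) ^ r := Real.rpow_nonneg (by linarith) r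
  unfold polyaMass
  positivity

theorem hasSum_polyaMass {r α : ℝ} (h0 : 0 < α) (h1 : α < 1) :
    HasSum (polyaMass r α) 1 := by
  have h := (Real.one_div_one_sub_rpow_hasFPowerSeriesOnBall_zero r).hasSum (y := α)
    (by simp [enorm_eq_nnnorm, ← NNReal.coe_lt_coe, abs_lt]; constructor <;> linarith)
  have hp : (1 - α) ^ r ≠ 0 := (Real.rpow_pos_of_pos (by linarith) r).ne'
  have h2 := h.mul_right ((1 - α) ^ r)
  rw [zero_add, one_div, inv_mul_cancel₀ hp] at h2
  refine (congrArg (HasSum · 1) (funext fun k => ?_)).mp h2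
  have hk : (k.factorial : ℝ) ≠ 0 := by positivity
  have hc : Ring.choose (r + k - 1) k = (ascPochhammer ℝ k).eval r / (k.factorial : ℝ) := by
    have h3 := Ring.factorial_nsmul_multichoose_eq_ascPochhammer r k
    rw [Polynomial.ascPochhammer_smeval_eq_eval] at h3
    rw [Ring.choose, show r + (k : ℝ) - 1 - k + 1 = r by ring, eq_div_iff hk, ← h3, nsmul_eq_mul]
    ring
  simp [polyaMass, FormalMultilinearSeries.ofScalars, hc]

/-- The Pólya(`r`, `α`) distribution on `ℕ` (negative binomial with real parameter `r`). -/
def polya (r α : ℝ) (hr : 0 < r) (h0 : 0 < α) (h1 : α < 1) : PMF ℕ :=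
  ⟨fun k => ENNReal.ofReal (polyaMass r α k), by
    have h := hasSum_polyaMass (r := r) h0 h1
    have := ENNReal.ofReal_tsum_of_nonneg (polyaMass_nonneg hr h0 h1) h.summable
    rw [h.tsum_eq, ENNReal.ofReal_one] at this
    rw [this]
    exact ENNReal.summable.hasSum⟩

/-- The Bernoulli distribution with success probability `t`. -/
def ber (t : ℝ) (h0 : 0 ≤ t) (h1 : t ≤ 1) : PMF Bool :=
  PMF.ofFintype (fun b => ENNReal.ofReal (if b then t else 1 - t)) (by
    rw [Fintype.sum_bool, ← ENNReal.ofReal_add (by simpa using h0) (by simpa using h1)]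
    simp)

/-- Fixed point encoding with randomized rounding: `⌊x p⌋ + Ber(x p - ⌊x p⌋)`. -/
def randomizedRounding (x : ℝ) (p : ℕ) : PMF ℤ :=
  (ber (Int.fract (x * p)) (Int.fract_nonneg _) (Int.fract_lt_one _).le).map
    fun b => ⌊x * p⌋ + if b then 1 else 0

theorem shares_nonempty {q k : ℕ} [NeZero q] [NeZero k] (y : ZMod q) :
    (Finset.univ.filter fun v : Fin k → ZMod q => ∑ j, v j = y).Nonempty :=
  ⟨Pi.single 0 y, by simp⟩

/-- `k` additive shares of `y`: the uniform distribution on `(ℤ/q)^k` conditioned on the sum of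
the coordinates being `y`. -/
def additiveShares {q : ℕ} (k : ℕ) [NeZero q] [NeZero k] (y : ZMod q) : PMF (Fin k → ZMod q) :=
  PMF.uniformOfFinset (Finset.univ.filter fun v : Fin k → ZMod q => ∑ j, v j = y)
    (shares_nonempty y)

/-! ### The shuffle model -/

/-- A protocol in the shuffle model for `n` parties: every party applies the local randomizer to
its input, which gives `k` messages; the analyzer sees the `n * k` shuffled messages. -/
structure Protocol (n : ℕ) (X Y O : Type) where
  /-- number of messages per party -/
  k : ℕ
  /-- the local randomizer -/
  localRandomizer : X → PMF (Fin k → Y)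
  /-- the analyzer -/
  analyzer : (Fin n × Fin k → Y) → O

/-- The shuffler: apply a uniformly random permutation. -/
def shuffler {ι Y : Type} [Fintype ι] [DecidableEq ι] (v : ι → Y) : PMF (ι → Y) :=
  (PMF.uniformOfFintype (Equiv.Perm ι)).map fun π : Equiv.Perm ι => v ∘ π

/-- The multiset of the entries of a tuple. -/
def toMultiset {ι Y : Type} [Fintype ι] (v : ι → Y) : Multiset Y :=
  Finset.univ.val.map v

namespace Protocol

variable {n : ℕ} {X Y O : Type}

/-- The view of the analyzer: the parties randomize independently, then all messages are
shuffled. -/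
def view (P : Protocol n X Y O) (x : Fin n → X) : PMF (Fin n × Fin P.k → Y) :=
  (indep fun i => P.localRandomizer (x i)).bind fun y => shuffler fun ij => y ij.1 ij.2

/-- The output of the whole protocol. -/
def output (P : Protocol n X Y O) (x : Fin n → X) : PMF O :=
  (P.view x).map P.analyzer

/-- `(ε, δ)`-differential privacy: for inputs that differ in one coordinate and for every
collection `T` of multisets of messages. -/
def IsDP (P : Protocol n X Y O) (ε δ : ℝ) : Prop :=
  ∀ (x x' : Fin n → X) (i : Fin n), (∀ j, j ≠ i → x j = x' j) → ∀ T : Set (Multiset Y),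
    ((P.view x).map toMultiset).toOuterMeasure T ≤
      ENNReal.ofReal (Real.exp ε) * ((P.view x').map toMultiset).toOuterMeasure T +
        ENNReal.ofReal δ

/-- Communication per party in bits: `k` messages, each a binary string of length `⌈log₂ |Y|⌉`. -/
def bitsPerParty (P : Protocol n X Y O) : ℕ :=
  P.k * Nat.clog 2 (Nat.card Y)

/-- The mean squared error of a protocol for real summation on the input `x`. -/
def mse (P : Protocol n unitInterval Y ℝ) (x : Fin n → unitInterval) : ℝ≥0∞ :=
  ∑' z : ℝ, P.output x z * ENNReal.ofReal ((z - ∑ i, (x i : ℝ)) ^ 2)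

end Protocol

/-! ### The private summation protocol -/

/-- The local randomizer: round `x` randomly with precision `p`, add the difference of two
independent Pólya(`1 / n`, `α`) variables, and output `k` additive shares modulo `q`. -/
def localRandomizer (n : ℕ) [NeZero n] (α : ℝ) (h0 : 0 < α) (h1 : α < 1) (k p q : ℕ)
    [NeZero k] [NeZero q] (x : unitInterval) : PMF (Fin k → ZMod q) :=
  have hn : (0 : ℝ) < 1 / n := one_div_pos.2 (Nat.cast_pos.2 (NeZero.pos n))
  (randomizedRounding x p).bind fun a =>
    (polya (1 / n) α hn h0 h1).bind fun b =>
      (polya (1 / n) α hn h0 h1).bind fun c =>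
        additiveShares k ((a + (b : ℤ) - (c : ℤ) : ℤ) : ZMod q)

/-- The analyzer: add all messages modulo `q` (with representative `z` in `{0, …, q - 1}`),
correct `z` for underflow if `z > (n p + q) / 2`, and rescale. -/
def analyzer (n k p q : ℕ) (y : Fin n × Fin k → ZMod q) : ℝ :=
  if ((n * p + q : ℕ) : ℝ) / 2 < ((∑ ij, y ij).val : ℝ) then
    (((∑ ij, y ij).val : ℝ) - q) / p
  else ((∑ ij, y ij).val : ℝ) / p

/-- The precision: `√n`, rounded up to an integer. -/
def precision (n : ℕ) : ℕ := ⌈Real.sqrt n⌉₊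

/-- The order of the additive group. -/
def groupOrder (n : ℕ) : ℕ := 2 * n * precision n

/-- The number of messages per party. -/
def numMessages (n : ℕ) (δ : ℝ) : ℕ :=
  2 + 5 * ⌈Real.logb 2 (groupOrder n)⌉₊ +
    2 * ⌈Real.logb 2 (1 / δ) + Real.logb 2 ((n : ℝ) - 1)⌉₊

/-- The noise parameter `α = exp (-ε / p)`. -/
def noiseParam (n : ℕ) (ε : ℝ) : ℝ := Real.exp (-ε / precision n)

theorem precision_pos (n : ℕ) [NeZero n] : 0 < precision n :=
  Nat.ceil_pos.2 (Real.sqrt_pos.2 (Nat.cast_pos.2 (NeZero.pos n)))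

instance (n : ℕ) [NeZero n] : NeZero (groupOrder n) :=
  ⟨(Nat.mul_pos (Nat.mul_pos two_pos (NeZero.pos n)) (precision_pos n)).ne'⟩

instance (n : ℕ) (δ : ℝ) : NeZero (numMessages n δ) :=
  ⟨by unfold numMessages; omega⟩

theorem noiseParam_lt_one (n : ℕ) [NeZero n] {ε : ℝ} (hε : 0 < ε) : noiseParam n ε < 1 := by
  have h : (0 : ℝ) < precision n := Nat.cast_pos.2 (precision_pos n)
  unfold noiseParam
  rw [← Real.exp_zero]
  exact Real.exp_lt_exp.2 (div_neg_of_neg_of_pos (neg_lt_zero.2 hε) h)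

/-- The protocol for private summation of `n` numbers in `[0, 1]`. -/
def summationProtocol (n : ℕ) [NeZero n] (ε δ : ℝ) (hε : 0 < ε) :
    Protocol n unitInterval (ZMod (groupOrder n)) ℝ where
  k := numMessages n δ
  localRandomizer := localRandomizer n (noiseParam n ε) (Real.exp_pos _) (noiseParam_lt_one n hε)
    (numMessages n δ) (precision n) (groupOrder n)
  analyzer := analyzer n (numMessages n δ) (precision n) (groupOrder n)

/-- The variance of the rescaled discrete Laplace noise plus the worst-case variance of the
randomized rounding. -/
def mseFormula (n : ℕ) (ε : ℝ) : ℝ :=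
  2 * noiseParam n ε / ((precision n : ℝ) ^ 2 * (1 - noiseParam n ε) ^ 2) +
    n / (4 * (precision n : ℝ) ^ 2)

end ShuffleSum

end

open ShuffleSum

noncomputable section

namespace ShuffleSum

/-! Privacy. The shuffled multiset reveals little beyond the sum of the noisy inputs modulo `q`. For
two parties, a test on the union of their messages is invariant under exchanging the parties'
entries at any set of positions. Averaging over all `2 ^ k` choices `T` of positions replaces the
indicator of "the first party's sum is `a`", minus the one for `a'`, by an average of functions
`mixedDiff` that are orthogonal unless the sets are equal or complementary. Cauchy-Schwarz then
bounds the advantage by a multiple of `q ^ 2 / 2 ^ (k / 2)` (`sq_sum_sumFiber_sub_le`), and a hybrid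
argument over `n - 1` pairs of parties extends this to `n` parties (`expect_shares_le`). The sum
itself is private: `n` Pólya(`1 / n`) variables add up to a geometric one, so the total noise is
discrete Laplace, and moving its centre by at most `p` costs a factor `α ^ (-p) = exp ε`
(`noisyExpect_le`).

Error. Rounding and noise are unbiased and independent, so without wrap-around modulo `q` the mean
squared error is a sum of variances (`expect_rounding_ideal`), largest when every `x i * p` has
fractional part `1 / 2`. Wrap-around needs one geometric variable to be at least `n p / 2`, which
has probability at most `exp (-ε n / 2)`; by memorylessness the squared error on that event is
bounded in terms of a shifted centre (`noisyExpect_decode_close`).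

Communication. Both `log q` and `k` are `O(log n)` for fixed `δ`. -/

/-- The expectation of a nonnegative function. -/
def expect {β : Type} (μ : PMF β) (f : β → ℝ≥0∞) : ℝ≥0∞ := ∑' b, μ b * f b

/-! ### Expectations with values in `[0, ∞]`, where sums may be exchanged freely. -/

section Expect

variable {β γ : Type}

theorem expect_pure (b : β) (f : β → ℝ≥0∞) : expect (PMF.pure b) f = f b := by
  unfold expect
  rw [tsum_eq_single b (fun c hc => by simp [hc])]
  simp

theorem expect_bind (μ : PMF β) (ν : β → PMF γ) (f : γ → ℝ≥0∞) :
    expect (μ.bind ν) f = expect μ fun b => expect (ν b) f := by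
  simp only [expect, PMF.bind_apply, ← ENNReal.tsum_mul_right, ← ENNReal.tsum_mul_left]
  rw [ENNReal.tsum_comm]
  simp only [mul_assoc]

theorem expect_map (μ : PMF β) (g : β → γ) (f : γ → ℝ≥0∞) :
    expect (μ.map g) f = expect μ fun b => f (g b) := by
  rw [PMF.map, expect_bind]
  exact congrArg _ (funext fun b => expect_pure _ _)

theorem expect_congr {μ : PMF β} {f g : β → ℝ≥0∞} (h : ∀ b ∈ μ.support, f b = g b) :
    expect μ f = expect μ g := by
  refine tsum_congr fun b => ?_
  by_cases hb : b ∈ μ.support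
  · rw [h b hb]
  · simp [(PMF.apply_eq_zero_iff μ b).2 hb]

theorem expect_mono' {μ : PMF β} {f g : β → ℝ≥0∞} (h : ∀ b ∈ μ.support, f b ≤ g b) :
    expect μ f ≤ expect μ g := by
  refine ENNReal.tsum_le_tsum fun b => ?_
  by_cases hb : b ∈ μ.support
  · exact mul_le_mul_right (h b hb) _
  · simp [(PMF.apply_eq_zero_iff μ b).2 hb]

theorem expect_mono {μ : PMF β} {f g : β → ℝ≥0∞} (h : ∀ b, f b ≤ g b) :
    expect μ f ≤ expect μ g :=
  expect_mono' fun b _ => h b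

theorem expect_const (μ : PMF β) (c : ℝ≥0∞) : expect μ (fun _ => c) = c := by
  simp [expect, ENNReal.tsum_mul_right]

theorem expect_add (μ : PMF β) (f g : β → ℝ≥0∞) :
    expect μ (fun b => f b + g b) = expect μ f + expect μ g := by
  simp [expect, mul_add, ENNReal.tsum_add]

theorem expect_const_mul (μ : PMF β) (c : ℝ≥0∞) (f : β → ℝ≥0∞) :
    expect μ (fun b => c * f b) = c * expect μ f := by
  simp only [expect, ← ENNReal.tsum_mul_left]
  exact tsum_congr fun b => by ring

theorem expect_comm (μ : PMF β) (ν : PMF γ) (f : β → γ → ℝ≥0∞) :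
    expect μ (fun b => expect ν (f b)) = expect ν fun c => expect μ fun b => f b c := by
  simp only [expect, ← ENNReal.tsum_mul_left]
  rw [ENNReal.tsum_comm]
  exact tsum_congr fun c => tsum_congr fun b => by ring

/-- If all values of `f` are bounded by all values of `g`, then so are the expectations. -/
theorem expect_le_expect {μ : PMF β} {ν : PMF γ} {f : β → ℝ≥0∞} {g : γ → ℝ≥0∞}
    (h : ∀ b ∈ μ.support, ∀ c ∈ ν.support, f b ≤ g c) : expect μ f ≤ expect ν g := by
  rw [← expect_const ν (expect μ f)]
  refine expect_mono' fun c hc => ?_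
  rw [← expect_const μ (g c)]
  exact expect_mono' fun b hb => h b hb c hc

theorem toOuterMeasure_eq_expect (μ : PMF β) (T : Set β) :
    μ.toOuterMeasure T = expect μ (T.indicator 1) := by
  rw [PMF.toOuterMeasure_apply]
  refine tsum_congr fun b => ?_
  by_cases hb : b ∈ T <;> simp [hb]

theorem expect_uniformOfFinset (s : Finset β) (hs : s.Nonempty) (f : β → ℝ≥0∞) :
    expect (PMF.uniformOfFinset s hs) f = (s.card : ℝ≥0∞)⁻¹ * ∑ b ∈ s, f b := by
  classical
  unfold expect
  rw [tsum_eq_sum (s := s) (fun b hb => by simp [hb]), Finset.mul_sum]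
  exact Finset.sum_congr rfl fun b hb => by simp [hb]

end Expect

/-! ### Independent families. -/

section Indep

variable {β γ : Type}

theorem indep_apply {n : ℕ} (μ : Fin n → PMF β) (b : Fin n → β) :
    indep μ b = ∏ i, μ i (b i) := rfl

theorem mem_support_indep {n : ℕ} {μ : Fin n → PMF β} {b : Fin n → β}
    (hb : b ∈ (indep μ).support) (i : Fin n) : b i ∈ (μ i).support := by
  rw [PMF.mem_support_iff, indep_apply, Finset.prod_ne_zero_iff] at hb
  exact hb i (Finset.mem_univ i)

/-- The `i`-th of several independent variables can be drawn first. -/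
theorem expect_indep_insertNth {n : ℕ} (i : Fin (n + 1)) (μ : Fin (n + 1) → PMF β)
    (f : (Fin (n + 1) → β) → ℝ≥0∞) :
    expect (indep μ) f = expect (μ i) fun a =>
      expect (indep fun j => μ (i.succAbove j)) fun b => f (i.insertNth a b) := by
  unfold expect
  rw [← (Fin.insertNthEquiv (fun _ : Fin (n + 1) => β) i).tsum_eq, ENNReal.tsum_prod']
  refine tsum_congr fun a => ?_
  rw [← ENNReal.tsum_mul_left]
  refine tsum_congr fun b => ?_
  change indep μ (i.insertNth a b) * f (i.insertNth a b) = _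
  simp [indep_apply, Fin.prod_univ_succAbove _ i, mul_assoc]

theorem expect_indep_zero (μ : Fin 0 → PMF β) (f : (Fin 0 → β) → ℝ≥0∞) :
    expect (indep μ) f = f Fin.elim0 := by
  have h : indep μ = PMF.pure Fin.elim0 := by
    ext b
    simp [indep_apply, Subsingleton.elim b Fin.elim0]
  rw [h, expect_pure]

theorem expect_indep_cons {n : ℕ} (μ : Fin (n + 1) → PMF β)
    (f : (Fin (n + 1) → β) → ℝ≥0∞) :
    expect (indep μ) f = expect (μ 0) fun a =>
      expect (indep fun j => μ j.succ) fun b => f (Fin.cons a b) := by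
  simpa using expect_indep_insertNth 0 μ f

theorem expect_indep_bind {n : ℕ} (μ : Fin n → PMF β) (ν : Fin n → β → PMF γ)
    (f : (Fin n → γ) → ℝ≥0∞) :
    expect (indep fun i => (μ i).bind (ν i)) f =
      expect (indep μ) fun b => expect (indep fun i => ν i (b i)) f := by
  induction n with
  | zero => simp only [expect_indep_zero]
  | succ n ih =>
    simp only [expect_indep_cons, expect_bind, ih, Fin.cons_zero, Fin.cons_succ]
    refine congrArg _ (funext fun a => ?_)
    rw [expect_comm]

end Indep

/-! ### Pólya and geometric distributions. -/

section Polya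

variable {α : ℝ} (h0 : 0 < α) (h1 : α < 1)

/-- The form with upper entry `-r` turns additivity in `r` into the Vandermonde identity. -/
theorem ascPochhammer_eval_div_factorial (r : ℝ) (k : ℕ) :
    (ascPochhammer ℝ k).eval r / (k.factorial : ℝ) = (-1) ^ k * Ring.choose (-r) k := by
  have h := Ring.factorial_nsmul_multichoose_eq_ascPochhammer r k
  rw [Polynomial.ascPochhammer_smeval_eq_eval, Ring.multichoose_eq, nsmul_eq_mul] at h
  have hk : (k.factorial : ℝ) ≠ 0 := by positivity
  have h2 := Ring.choose_neg r k
  rw [Units.smul_def, zsmul_eq_mul] at h2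
  rw [← h, h2, mul_div_cancel_left₀ _ hk, ← mul_assoc]
  simp [Int.negOnePow_def, ← mul_pow]

/-- Chu-Vandermonde: Pólya mass functions with the same `α` convolve. -/
theorem polyaMass_add {α : ℝ} (h1 : α < 1) (r s : ℝ) (k : ℕ) :
    polyaMass (r + s) α k =
      ∑ x ∈ Finset.HasAntidiagonal.antidiagonal k, polyaMass r α x.1 * polyaMass s α x.2 := by
  simp only [polyaMass, ascPochhammer_eval_div_factorial]
  rw [neg_add, Ring.add_choose_eq k (Commute.all _ _), Finset.mul_sum, Finset.sum_mul,
    Finset.sum_mul]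
  refine Finset.sum_congr rfl fun x hx => ?_
  rw [← Finset.HasAntidiagonal.mem_antidiagonal.1 hx, Real.rpow_add (by linarith)]
  ring

theorem polya_apply (r : ℝ) (hr : 0 < r) (k : ℕ) :
    polya r α hr h0 h1 k = ENNReal.ofReal (polyaMass r α k) := rfl

theorem expect_polya_add {r s : ℝ} (hr : 0 < r) (hs : 0 < s) (f : ℕ → ℝ≥0∞) :
    expect (polya r α hr h0 h1) (fun b => expect (polya s α hs h0 h1) fun c => f (b + c)) =
      expect (polya (r + s) α (add_pos hr hs) h0 h1) f := by
  unfold expect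
  simp only [← ENNReal.tsum_mul_left]
  rw [← ENNReal.tsum_prod, ← Finset.HasAntidiagonal.sigmaAntidiagonalEquivProd.tsum_eq, ENNReal.tsum_sigma']
  refine tsum_congr fun k => ?_
  rw [tsum_fintype, polya_apply, polyaMass_add h1, ENNReal.ofReal_sum_of_nonneg, Finset.sum_mul,
    ← Finset.sum_coe_sort (Finset.HasAntidiagonal.antidiagonal k)]
  · refine Finset.sum_congr rfl fun x _ => ?_
    rw [ENNReal.ofReal_mul (polyaMass_nonneg hr h0 h1 _), Finset.HasAntidiagonal.sigmaAntidiagonalEquivProd_apply,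
      Finset.HasAntidiagonal.mem_antidiagonal.1 x.2, polya_apply, polya_apply, mul_assoc]
  · exact fun x _ => mul_nonneg (polyaMass_nonneg hr h0 h1 _) (polyaMass_nonneg hs h0 h1 _)

/-- The sum of `n` independent Pólya(`r`) variables is a Pólya(`n r`) variable. -/
theorem expect_indep_polya {r s : ℝ} (hr : 0 < r) (hs : 0 < s) (n : ℕ)
    (hrs : s = (n + 1 : ℕ) * r) (f : ℕ → ℝ≥0∞) :
    expect (indep fun _ : Fin (n + 1) => polya r α hr h0 h1) (fun b => f (∑ i, b i)) =
      expect (polya s α hs h0 h1) f := by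
  induction n generalizing s f with
  | zero =>
    obtain rfl : s = r := by simpa using hrs
    simp [expect_indep_cons, expect_indep_zero]
  | succ n ih =>
    have hs' : 0 < ((n + 1 : ℕ) : ℝ) * r := by positivity
    obtain rfl : s = r + ((n + 1 : ℕ) : ℝ) * r := by rw [hrs]; push_cast; ring
    rw [expect_indep_cons, ← expect_polya_add h0 h1 hr hs']
    refine congrArg _ (funext fun a => ?_)
    simp only [Fin.sum_univ_succ, Fin.cons_zero, Fin.cons_succ]
    rw [← ih hs' rfl (fun b => f (a + b))]
    simp only [Fin.sum_univ_succ]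

/-- The geometric distribution. -/
def geometric : PMF ℕ := polya 1 α one_pos h0 h1

theorem geometric_apply (k : ℕ) : geometric h0 h1 k = ENNReal.ofReal (α ^ k * (1 - α)) := by
  have hk : (k.factorial : ℝ) ≠ 0 := by positivity
  rw [geometric, polya_apply, polyaMass, ascPochhammer_eval_one, div_self hk, one_mul,
    Real.rpow_one]

/-- The geometric distribution is memoryless. -/
theorem expect_geometric_add (m : ℕ) (f : ℕ → ℝ≥0∞) :
    ENNReal.ofReal (α ^ m) * expect (geometric h0 h1) (fun k => f (k + m)) =
      expect (geometric h0 h1) fun k => if m ≤ k then f k else 0 := by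
  unfold expect
  rw [← ENNReal.tsum_mul_left]
  symm
  rw [← ENNReal.summable.sum_add_tsum_nat_add' (k := m) (f := fun b => _ * ite _ _ _),
    Finset.sum_eq_zero (fun i hi => by simp [Finset.mem_range.1 hi]), zero_add]
  refine tsum_congr fun k => ?_
  simp only [le_add_iff_nonneg_left, zero_le, if_true, geometric_apply]
  rw [← mul_assoc, ← ENNReal.ofReal_mul (by positivity)]
  ring_nf

theorem expect_geometric_add_le (m : ℕ) (f : ℕ → ℝ≥0∞) :
    ENNReal.ofReal (α ^ m) * expect (geometric h0 h1) (fun k => f (k + m)) ≤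
      expect (geometric h0 h1) f := by
  rw [expect_geometric_add]
  refine expect_mono fun k => ?_
  split_ifs <;> simp

end Polya

/-! ### The view as a multiset of messages. -/

section View

theorem toMultiset_comp_perm {ι Y : Type} [Fintype ι] (v : ι → Y) (π : Equiv.Perm ι) :
    toMultiset (v ∘ π) = toMultiset v := by
  classical
  unfold toMultiset
  have h : Finset.univ.val.map π = (Finset.univ : Finset ι).val := by
    simp
  conv_rhs => rw [← h]
  rw [Multiset.map_map]

theorem toMultiset_eq_sum {ι Y : Type} [Fintype ι] (v : ι → Y) :
    toMultiset v = ∑ i, {v i} := by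
  rw [toMultiset, ← Multiset.sum_map_singleton (Finset.univ.val.map v), Multiset.map_map]
  rfl

theorem toMultiset_uncurry {n k : ℕ} {Y : Type} (v : Fin n → Fin k → Y) :
    toMultiset (fun ij : Fin n × Fin k => v ij.1 ij.2) = ∑ i, toMultiset (v i) := by
  simp only [toMultiset_eq_sum, Fintype.sum_prod_type]

/-- The multiset of messages is the union of those of the parties. -/
theorem Protocol.expect_view {n : ℕ} {X Y O : Type} (P : Protocol n X Y O) (x : Fin n → X)
    (H : Multiset Y → ℝ≥0∞) :
    expect (P.view x) (fun v => H (toMultiset v)) =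
      expect (indep fun i => P.localRandomizer (x i)) fun v => H (∑ i, toMultiset (v i)) := by
  rw [Protocol.view, expect_bind]
  refine congrArg _ (funext fun v => ?_)
  rw [shuffler, expect_map]
  simp only [toMultiset_comp_perm, expect_const, toMultiset_uncurry]

variable {n : ℕ} [NeZero n] {α : ℝ} (h0 : 0 < α) (h1 : α < 1)

/-- Infinite divisibility: each party contributes an `n`-th part of a single geometric variable. -/
theorem expect_indep_polya_one_div (hn : (0 : ℝ) < 1 / n) (f : ℕ → ℝ≥0∞) :
    expect (indep fun _ : Fin n => polya (1 / n) α hn h0 h1) (fun b => f (∑ i, b i)) =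
      expect (geometric h0 h1) f := by
  obtain ⟨m, rfl⟩ := Nat.exists_eq_succ_of_ne_zero (NeZero.ne n)
  exact expect_indep_polya h0 h1 hn one_pos m (by simp; field_simp) f

theorem expect_indep_localRandomizer (k p q : ℕ) [NeZero k] [NeZero q]
    (hn : (0 : ℝ) < 1 / n) (x : Fin n → unitInterval) (f : (Fin n → Fin k → ZMod q) → ℝ≥0∞) :
    expect (indep fun i => localRandomizer n α h0 h1 k p q (x i)) f =
      expect (indep fun i => randomizedRounding (x i) p) fun a =>
        expect (indep fun _ : Fin n => polya (1 / n) α hn h0 h1) fun b =>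
          expect (indep fun _ : Fin n => polya (1 / n) α hn h0 h1) fun c =>
            expect (indep fun i =>
              additiveShares k ((a i + (b i : ℤ) - (c i : ℤ) : ℤ) : ZMod q)) f := by
  unfold localRandomizer
  rw [expect_indep_bind]
  refine congrArg _ (funext fun a => ?_)
  rw [expect_indep_bind]
  refine congrArg _ (funext fun b => ?_)
  rw [expect_indep_bind]

end View

/-! ### Sums after exchanging entries of two vectors. -/

section MixedSum

variable {G : Type} [AddCommGroup G] {k : ℕ}

/-- The sum of the entries of `w.1` with index in `T` and of the entries of `w.2` with index
outside `T`. -/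
def mixedSum (T : Finset (Fin k)) (w : (Fin k → G) × (Fin k → G)) : G :=
  ∑ i, T.piecewise w.1 w.2 i

theorem mixedSum_add (T : Finset (Fin k)) (w h : (Fin k → G) × (Fin k → G)) :
    mixedSum T (w + h) = mixedSum T w + mixedSum T h := by
  unfold mixedSum
  rw [← Finset.sum_add_distrib]
  refine Finset.sum_congr rfl fun i _ => ?_
  by_cases hi : i ∈ T <;> simp [hi]

theorem mixedSum_single (T : Finset (Fin k)) (i : Fin k) (s t : G) :
    mixedSum T (Pi.single i s, Pi.single i t) = if i ∈ T then s else t := by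
  unfold mixedSum
  rw [Finset.sum_eq_single i (fun j _ hj => by by_cases h : j ∈ T <;> simp [h, hj]) (by simp)]
  by_cases h : i ∈ T <;> simp [h]

/-- The sum of all entries. -/
def totalSum (w : (Fin k → G) × (Fin k → G)) : G := ∑ i, w.1 i + ∑ i, w.2 i

theorem totalSum_add (w h : (Fin k → G) × (Fin k → G)) :
    totalSum (w + h) = totalSum w + totalSum h := by
  simp only [totalSum, Prod.fst_add, Prod.snd_add, Pi.add_apply, Finset.sum_add_distrib]
  abel

theorem totalSum_single (i : Fin k) (s t : G) :
    totalSum (Pi.single i s, Pi.single i t) = s + t := by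
  simp [totalSum]

/-- If `T'` is neither `T` nor its complement, then the mixed sum over `T'` can be changed while
keeping the total sum and the mixed sum over `T`. -/
theorem exists_shift {T T' : Finset (Fin k)} (h1 : T ≠ T') (h2 : T ≠ T'ᶜ) (t : G) :
    ∃ h : (Fin k → G) × (Fin k → G),
      totalSum h = 0 ∧ mixedSum T h = 0 ∧ mixedSum T' h = t := by
  obtain ⟨i, hi⟩ : ∃ i, ¬(i ∈ T ↔ i ∈ T') := by
    by_contra! h
    exact h1 (Finset.ext h)
  obtain ⟨j, hj⟩ : ∃ j, (j ∈ T ↔ j ∈ T') := by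
    by_contra! h
    refine h2 (Finset.ext fun j => ?_)
    have := h j
    rw [Finset.mem_compl]
    tauto
  -- At `i` the sets differ, so `t` can be put into the entry read by `T'` but not by `T`. At `j`
  -- they agree, so `-t` can be put into the entry read by neither; this restores the total.
  refine ⟨(Pi.single i (if i ∈ T' then t else 0), Pi.single i (if i ∈ T' then 0 else t)) +
    (Pi.single j (if j ∈ T then 0 else -t), Pi.single j (if j ∈ T then -t else 0)), ?_, ?_, ?_⟩
  · rw [totalSum_add, totalSum_single, totalSum_single]
    split_ifs <;> simp
  · rw [mixedSum_add, mixedSum_single, mixedSum_single]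
    split_ifs <;> first | (exfalso; tauto) | simp
  · rw [mixedSum_add, mixedSum_single, mixedSum_single]
    split_ifs <;> first | (exfalso; tauto) | simp

/-- Exchange the entries of `w.1` and `w.2` with index outside `T`. -/
def swapOutside (T : Finset (Fin k)) : Equiv.Perm ((Fin k → G) × (Fin k → G)) :=
  Function.Involutive.toPerm (fun w => (T.piecewise w.1 w.2, T.piecewise w.2 w.1)) fun w => by
    ext i <;> by_cases hi : i ∈ T <;> simp [hi]

theorem totalSum_swapOutside (T : Finset (Fin k)) (w : (Fin k → G) × (Fin k → G)) :
    totalSum (swapOutside T w) = totalSum w := by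
  change ∑ i, T.piecewise w.1 w.2 i + ∑ i, T.piecewise w.2 w.1 i = ∑ i, w.1 i + ∑ i, w.2 i
  rw [← Finset.sum_add_distrib, ← Finset.sum_add_distrib]
  refine Finset.sum_congr rfl fun i _ => ?_
  by_cases hi : i ∈ T <;> simp [hi, add_comm]

end MixedSum

/-! ### Second moment bound for two parties. -/

section TwoParties

variable {G : Type} [AddCommGroup G] [DecidableEq G] {k : ℕ}

/-- The difference of the indicator functions of `mixedSum T w = a` and `mixedSum T w = a'`,
restricted to total sum `s`. -/
def mixedDiff (s a a' : G) (T : Finset (Fin k)) (w : (Fin k → G) × (Fin k → G)) : ℝ :=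
  if totalSum w = s then (if mixedSum T w = a then 1 else 0) - (if mixedSum T w = a' then 1 else 0)
  else 0

theorem abs_mixedDiff_le_one (s a a' : G) (T : Finset (Fin k)) (w : (Fin k → G) × (Fin k → G)) :
    |mixedDiff s a a' T w| ≤ 1 := by
  unfold mixedDiff
  split_ifs <;> simp

variable [Fintype G]

/-- Translation by the vector of `exists_shift` fixes the total and the mixed sum over `T` and moves
that over `T'` from `a` to `a'`. Hence the two indicators in the second factor have equal weight
against the first factor. -/
theorem sum_mixedDiff_mul_eq_zero (s a a' : G) {T T' : Finset (Fin k)} (h1 : T ≠ T')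
    (h2 : T ≠ T'ᶜ) : ∑ w, mixedDiff s a a' T w * mixedDiff s a a' T' w = 0 := by
  obtain ⟨h, ht, hT, hT'⟩ := exists_shift h1 h2 (a' - a)
  have key : ∑ w, mixedDiff s a a' T w * (if mixedSum T' w = a' then 1 else 0) =
      ∑ w, mixedDiff s a a' T w * (if mixedSum T' w = a then 1 else 0) := by
    rw [← Equiv.sum_comp (Equiv.addRight h)]
    refine Finset.sum_congr rfl fun w _ => ?_
    simp only [Equiv.coe_addRight, mixedDiff, totalSum_add, mixedSum_add, ht, hT, hT', add_zero,
      ← eq_sub_iff_add_eq, sub_sub_cancel]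
  rw [← sub_eq_zero, ← Finset.sum_sub_distrib] at key
  rw [← neg_eq_zero, ← Finset.sum_neg_distrib, ← key]
  refine Finset.sum_congr rfl fun w _ => ?_
  unfold mixedDiff
  by_cases hw : totalSum w = s
  · simp only [hw, if_true]; ring
  · simp only [hw, if_false]; ring

/-- After expanding the square, only `T = T'` and `T = T'ᶜ` survive: `2 * 2 ^ k` terms, each at most
the number of pairs of vectors. -/
theorem sum_sq_sum_mixedDiff_le (s a a' : G) :
    ∑ w, (∑ T : Finset (Fin k), mixedDiff s a a' T w) ^ 2 ≤
      2 * 2 ^ k * ((Fintype.card G : ℝ) ^ (2 * k)) := by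
  have hcard : (Fintype.card ((Fin k → G) × (Fin k → G)) : ℝ) = (Fintype.card G : ℝ) ^ (2 * k) := by
    simp [two_mul, pow_add]
  have h1 : ∀ T T' : Finset (Fin k), ∑ w, mixedDiff s a a' T w * mixedDiff s a a' T' w ≤
      (if T = T' then (Fintype.card G : ℝ) ^ (2 * k) else 0) +
        if T = T'ᶜ then (Fintype.card G : ℝ) ^ (2 * k) else 0 := by
    intro T T'
    have hle : ∑ w, mixedDiff s a a' T w * mixedDiff s a a' T' w ≤
        (Fintype.card G : ℝ) ^ (2 * k) := by
      rw [← hcard, ← Finset.card_univ, ← nsmul_one, ← Finset.sum_const]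
      refine Finset.sum_le_sum fun w _ => ?_
      refine (le_abs_self _).trans ?_
      rw [abs_mul]
      exact mul_le_one₀ (abs_mixedDiff_le_one ..) (abs_nonneg _) (abs_mixedDiff_le_one ..)
    have h0 : (0 : ℝ) ≤ (Fintype.card G : ℝ) ^ (2 * k) := by positivity
    by_cases hT : T = T'
    · rw [if_pos hT]
      split_ifs <;> linarith
    · by_cases hT' : T = T'ᶜ
      · rw [if_neg hT, if_pos hT', zero_add]
        exact hle
      · rw [if_neg hT, if_neg hT', sum_mixedDiff_mul_eq_zero s a a' hT hT', zero_add]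
  calc ∑ w, (∑ T : Finset (Fin k), mixedDiff s a a' T w) ^ 2
      = ∑ T : Finset (Fin k), ∑ T' : Finset (Fin k),
          ∑ w, mixedDiff s a a' T w * mixedDiff s a a' T' w := by
        simp only [sq, Finset.sum_mul_sum]
        rw [Finset.sum_comm]
        exact Finset.sum_congr rfl fun T _ => Finset.sum_comm
    _ ≤ ∑ T' : Finset (Fin k), ∑ T : Finset (Fin k),
        ((if T = T' then (Fintype.card G : ℝ) ^ (2 * k) else 0) +
          if T = T'ᶜ then (Fintype.card G : ℝ) ^ (2 * k) else 0) := by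
        rw [Finset.sum_comm]
        exact Finset.sum_le_sum fun T' _ => Finset.sum_le_sum fun T _ => h1 T T'
    _ = 2 * 2 ^ k * ((Fintype.card G : ℝ) ^ (2 * k)) := by
        simp [Finset.sum_add_distrib]
        ring

/-- The vectors with sum `a`. -/
def sumFiber (k : ℕ) (a : G) : Finset (Fin k → G) :=
  Finset.univ.filter fun v => ∑ j, v j = a

/-- Translating coordinate `0` identifies all fibers. The product form avoids the exponent `k - 1`.
-/
theorem card_sumFiber [NeZero k] (a : G) :
    (sumFiber k a).card * Fintype.card G = Fintype.card G ^ k := by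
  have h : ∀ b : G, (sumFiber k b).card = (sumFiber k a).card := by
    intro b
    refine Finset.card_equiv (Equiv.addRight (Pi.single 0 (a - b))) fun v => ?_
    simp [sumFiber, Finset.sum_add_distrib, ← eq_sub_iff_add_eq]
  have h2 := Finset.card_eq_sum_card_fiberwise (s := (Finset.univ : Finset (Fin k → G)))
    (t := Finset.univ) (f := fun v => ∑ j, v j) (fun _ _ => Finset.mem_coe.2 (Finset.mem_univ _))
  change _ = ∑ b, (sumFiber k b).card at h2
  simp only [h] at h2
  simpa [mul_comm] using h2.symm

/-- A function that is invariant under exchanging entries of its two arguments hardly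
distinguishes a pair of vectors with sums `a`, `b` from one with sums `a'`, `b'`, if
`a + b = a' + b'`. -/
theorem sq_sum_sumFiber_sub_le {a b a' b' : G} (hab : a + b = a' + b')
    (f : (Fin k → G) → (Fin k → G) → ℝ) (hf : ∀ u v, |f u v| ≤ 1)
    (hsym : ∀ (T : Finset (Fin k)) u v, f (T.piecewise u v) (T.piecewise v u) = f u v) :
    (∑ u ∈ sumFiber k a, ∑ v ∈ sumFiber k b, f u v -
        ∑ u ∈ sumFiber k a', ∑ v ∈ sumFiber k b', f u v) ^ 2 * 2 ^ k ≤
      2 * (Fintype.card G : ℝ) ^ (4 * k) := by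
  set d := ∑ u ∈ sumFiber k a, ∑ v ∈ sumFiber k b, f u v -
        ∑ u ∈ sumFiber k a', ∑ v ∈ sumFiber k b', f u v with hd
  have hform : ∀ c e : G, c + e = a + b → ∑ u ∈ sumFiber k c, ∑ v ∈ sumFiber k e, f u v =
      ∑ w : (Fin k → G) × (Fin k → G), f w.1 w.2 *
        if totalSum w = a + b then (if ∑ i, w.1 i = c then 1 else 0) else 0 := by
    intro c e hce
    simp only [sumFiber, Finset.sum_filter, Fintype.sum_prod_type]
    refine Finset.sum_congr rfl fun u _ => ?_
    by_cases hu : ∑ i, u i = c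
    · simp only [hu, if_true, totalSum, ← hce, add_right_inj, mul_ite, mul_one, mul_zero]
    · simp [hu]
  -- Substituting `swapOutside T` leaves `f` and the total unchanged, but turns the sum of the first
  -- vector into the mixed sum over `T`.
  have hT : ∀ T : Finset (Fin k), d = ∑ w : (Fin k → G) × (Fin k → G),
      f w.1 w.2 * mixedDiff (a + b) a a' T w := by
    intro T
    rw [hd, hform a b rfl, hform a' b' hab.symm, ← Finset.sum_sub_distrib,
      ← Equiv.sum_comp (swapOutside T)]
    refine Finset.sum_congr rfl fun w _ => ?_
    rw [totalSum_swapOutside]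
    change f (T.piecewise w.1 w.2) (T.piecewise w.2 w.1) * (if _ then
      (if mixedSum T w = a then 1 else 0) else 0) - f (T.piecewise w.1 w.2)
      (T.piecewise w.2 w.1) * (if _ then (if mixedSum T w = a' then 1 else 0) else 0) = _
    rw [hsym, mixedDiff]
    by_cases hw : totalSum w = a + b
    · simp only [hw, if_true]; ring
    · simp only [hw, if_false]; ring
  -- Since `d` does not depend on `T`, summing over all `T` brings in the nearly orthogonal family;
  -- Cauchy-Schwarz follows.
  have hsum : 2 ^ k * d = ∑ w : (Fin k → G) × (Fin k → G),
      f w.1 w.2 * ∑ T : Finset (Fin k), mixedDiff (a + b) a a' T w := by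
    simp only [Finset.mul_sum]
    rw [Finset.sum_comm, ← Finset.sum_congr rfl fun T _ => hT T]
    simp
  have hf2 : ∑ w : (Fin k → G) × (Fin k → G), f w.1 w.2 ^ 2 ≤ (Fintype.card G : ℝ) ^ (2 * k) := by
    have : (Fintype.card ((Fin k → G) × (Fin k → G)) : ℝ) = (Fintype.card G : ℝ) ^ (2 * k) := by
      simp [two_mul, pow_add]
    rw [← this, ← Finset.card_univ, ← nsmul_one, ← Finset.sum_const]
    exact Finset.sum_le_sum fun w _ => (sq_le_one_iff_abs_le_one _).2 (hf _ _)
  have hcs := Finset.sum_mul_sq_le_sq_mul_sq Finset.univ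
    (fun w : (Fin k → G) × (Fin k → G) => f w.1 w.2)
    (fun w => ∑ T : Finset (Fin k), mixedDiff (a + b) a a' T w)
  rw [← hsum] at hcs
  have h2 := hcs.trans (mul_le_mul hf2 (sum_sq_sum_mixedDiff_le (a + b) a a')
    (Finset.sum_nonneg fun w _ => sq_nonneg _) (by positivity))
  have hk : (0 : ℝ) < 2 ^ k := by positivity
  refine le_of_mul_le_mul_left ?_ hk
  calc (2 : ℝ) ^ k * (d ^ 2 * 2 ^ k) = (2 ^ k * d) ^ 2 := by ring
    _ ≤ _ := h2
    _ = _ := by ring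

end TwoParties

/-! ### Additive shares reveal little but the sum. -/

section Shares

variable {q k : ℕ} [NeZero q] [NeZero k]

theorem expect_additiveShares (a : ZMod q) (f : (Fin k → ZMod q) → ℝ≥0∞) :
    expect (additiveShares k a) f = ((q : ℝ≥0∞) / q ^ k) * ∑ u ∈ sumFiber k a, f u := by
  have hq : (q : ℝ≥0∞) ≠ 0 := by exact_mod_cast NeZero.ne q
  have hc : ((sumFiber k a).card : ℝ≥0∞) * q = q ^ k := by
    have := card_sumFiber (k := k) a
    rw [ZMod.card] at this
    exact_mod_cast this
  rw [additiveShares, expect_uniformOfFinset]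
  change ((sumFiber k a).card : ℝ≥0∞)⁻¹ * _ = _
  congr 1
  have hc0 : ((sumFiber k a).card : ℝ≥0∞) ≠ 0 := by
    intro h
    rw [h, zero_mul] at hc
    exact pow_ne_zero k hq hc.symm
  rw [← hc, ENNReal.div_eq_inv_mul, ENNReal.mul_inv (Or.inl hc0) (Or.inr hq), mul_assoc,
    ENNReal.inv_mul_cancel hq (by simp), mul_one]

theorem sum_eq_of_mem_support_additiveShares {a : ZMod q} {u : Fin k → ZMod q}
    (hu : u ∈ (additiveShares k a).support) : ∑ j, u j = a := by
  simpa [additiveShares] using hu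

theorem toMultiset_piecewise_add {Y : Type} {k : ℕ} (T : Finset (Fin k)) (u v : Fin k → Y) :
    toMultiset (T.piecewise u v) + toMultiset (T.piecewise v u) = toMultiset u + toMultiset v := by
  simp only [toMultiset_eq_sum, ← Finset.sum_add_distrib]
  refine Finset.sum_congr rfl fun i _ => ?_
  by_cases hi : i ∈ T <;> simp [hi, add_comm]

/-- Two parties: the union of the additive shares of `a` and `b` nearly determines only the
sum. -/
theorem expect_shares_two_le {η : ℝ} (hη : 0 ≤ η) (hη2 : 2 * (q : ℝ) ^ 4 ≤ η ^ 2 * 2 ^ k)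
    {a b a' b' : ZMod q} (hab : a + b = a' + b') (F : Multiset (ZMod q) → ℝ≥0∞)
    (hF : ∀ s, F s ≤ 1) :
    (expect (additiveShares k a) fun u => expect (additiveShares k b) fun v =>
        F (toMultiset u + toMultiset v)) ≤
      (expect (additiveShares k a') fun u => expect (additiveShares k b') fun v =>
        F (toMultiset u + toMultiset v)) + ENNReal.ofReal η := by
  have hq : (0 : ℝ) < q := by exact_mod_cast NeZero.pos q
  set f : (Fin k → ZMod q) → (Fin k → ZMod q) → ℝ := fun u v =>
    (F (toMultiset u + toMultiset v)).toReal with hf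
  have hFf : ∀ u v, F (toMultiset u + toMultiset v) = ENNReal.ofReal (f u v) := fun u v =>
    (ENNReal.ofReal_toReal ((hF _).trans_lt ENNReal.one_lt_top).ne).symm
  have hf0 : ∀ u v, 0 ≤ f u v := fun u v => ENNReal.toReal_nonneg
  have hf1 : ∀ u v, |f u v| ≤ 1 := fun u v => by
    rw [abs_of_nonneg (hf0 u v)]
    simpa using ENNReal.toReal_mono ENNReal.one_ne_top (hF _)
  have hqq : (q : ℝ≥0∞) / q ^ k = ENNReal.ofReal ((q : ℝ) / q ^ k) := by
    rw [ENNReal.ofReal_div_of_pos (by positivity), ENNReal.ofReal_pow hq.le, ENNReal.ofReal_natCast]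
  have hform : ∀ c e : ZMod q, (expect (additiveShares k c) fun u =>
      expect (additiveShares k e) fun v => F (toMultiset u + toMultiset v)) =
      ENNReal.ofReal (((q : ℝ) / q ^ k) ^ 2 * ∑ u ∈ sumFiber k c, ∑ v ∈ sumFiber k e, f u v) := by
    intro c e
    simp only [expect_additiveShares, hFf, hqq]
    rw [← Finset.mul_sum, ENNReal.ofReal_mul (by positivity), ENNReal.ofReal_pow (by positivity),
      ENNReal.ofReal_sum_of_nonneg (fun u _ => Finset.sum_nonneg fun v _ => hf0 u v), sq, mul_assoc]
    simp only [ENNReal.ofReal_sum_of_nonneg (fun v _ => hf0 _ v)]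
  rw [hform, hform, ← ENNReal.ofReal_add (mul_nonneg (by positivity)
    (Finset.sum_nonneg fun u _ => Finset.sum_nonneg fun v _ => hf0 u v)) hη]
  refine ENNReal.ofReal_le_ofReal ?_
  have hmain := sq_sum_sumFiber_sub_le hab f hf1 fun T u v => by
    simp only [hf, toMultiset_piecewise_add]
  set S := ∑ u ∈ sumFiber k a, ∑ v ∈ sumFiber k b, f u v
  set S' := ∑ u ∈ sumFiber k a', ∑ v ∈ sumFiber k b', f u v
  rw [ZMod.card] at hmain
  rw [← sub_le_iff_le_add', ← mul_sub]
  refine (abs_le_of_sq_le_sq' ?_ hη).2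
  have h2k : (0 : ℝ) < 2 ^ k := by positivity
  refine le_of_mul_le_mul_right ?_ h2k
  refine le_trans ?_ hη2
  -- The normalization `q / q ^ k` is the reciprocal of the size of a fiber; its fourth power
  -- cancels `q ^ (4 * k)` and leaves `q ^ 4`.
  calc (((q : ℝ) / q ^ k) ^ 2 * (S - S')) ^ 2 * 2 ^ k
      = ((q : ℝ) / q ^ k) ^ 4 * ((S - S') ^ 2 * 2 ^ k) := by ring
    _ ≤ ((q : ℝ) / q ^ k) ^ 4 * (2 * (q : ℝ) ^ (4 * k)) := by gcongr
    _ = 2 * (q : ℝ) ^ 4 := by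
      field_simp
      ring

/-- Hybrid argument: the union of the additive shares of several parties nearly determines only
the sum of their inputs. -/
theorem expect_shares_le {η : ℝ} (hη : 0 ≤ η) (hη2 : 2 * (q : ℝ) ^ 4 ≤ η ^ 2 * 2 ^ k) (n : ℕ)
    {y y' : Fin (n + 1) → ZMod q} (hy : ∑ i, y i = ∑ i, y' i) (F : Multiset (ZMod q) → ℝ≥0∞)
    (hF : ∀ s, F s ≤ 1) :
    expect (indep fun i => additiveShares k (y i)) (fun v => F (∑ i, toMultiset (v i))) ≤
      expect (indep fun i => additiveShares k (y' i)) (fun v => F (∑ i, toMultiset (v i))) +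
        n * ENNReal.ofReal η := by
  induction n generalizing F with
  | zero =>
    obtain rfl : y = y' := by
      ext i
      rw [Fin.fin_one_eq_zero i]
      simpa using hy
    simp
  | succ n ih =>
    rw [Fin.sum_univ_succ y, Fin.sum_univ_succ y'] at hy
    -- Party `0` gets its target value `y' 0` and party `1` absorbs the difference, so the remaining
    -- `n + 1` parties have the right sum for induction.
    set z : Fin (n + 1) → ZMod q := Fin.cons (y 0 + y (Fin.succ 0) - y' 0) fun i => y i.succ.succ with hz
    have hz' : ∑ i, z i = ∑ i : Fin (n + 1), y' i.succ := by
      rw [Fin.sum_univ_succ fun i : Fin (n + 1) => y i.succ] at hy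
      rw [Fin.sum_univ_succ]
      simp only [hz, Fin.cons_zero, Fin.cons_succ]
      rw [← add_right_inj (y' 0), ← hy]
      abel
    have h1 : expect (indep fun i => additiveShares k (y i))
          (fun v => F (∑ i, toMultiset (v i))) ≤
        (expect (additiveShares k (y' 0)) fun u => expect (indep fun i => additiveShares k (z i))
          fun v => F (toMultiset u + ∑ i, toMultiset (v i))) + ENNReal.ofReal η := by
      simp only [expect_indep_cons, Fin.sum_univ_succ, Fin.cons_zero, Fin.cons_succ, hz]
      -- Conditioning on the messages of all other parties reduces this replacement to the two-party
      -- bound.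
      have hpull : ∀ c e : ZMod q, (expect (additiveShares k c) fun u =>
          expect (additiveShares k e) fun v => expect (indep fun i : Fin n => additiveShares k
            (y i.succ.succ)) fun w => F (toMultiset u + (toMultiset v + ∑ i, toMultiset (w i)))) =
          expect (indep fun i : Fin n => additiveShares k (y i.succ.succ)) fun w =>
            expect (additiveShares k c) fun u => expect (additiveShares k e) fun v =>
              F (toMultiset u + toMultiset v + ∑ i, toMultiset (w i)) := by
        intro c e
        simp only [add_assoc]
        exact (congrArg _ (funext fun u => expect_comm _ _ _)).trans (expect_comm _ _ _)
      rw [hpull, hpull, ← expect_const (indep fun i : Fin n => additiveShares k (y i.succ.succ))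
        (ENNReal.ofReal η), ← expect_add]
      refine expect_mono fun w => ?_
      exact expect_shares_two_le hη hη2 (by abel)
        (fun s => F (s + ∑ i, toMultiset (w i))) fun s => hF _
    refine h1.trans ?_
    have h2 : (expect (additiveShares k (y' 0)) fun u =>
          expect (indep fun i => additiveShares k (z i))
            fun v => F (toMultiset u + ∑ i, toMultiset (v i))) ≤
        expect (indep fun i => additiveShares k (y' i)) (fun v => F (∑ i, toMultiset (v i))) +
          n * ENNReal.ofReal η := by
      rw [expect_indep_cons]
      simp only [Fin.sum_univ_succ (n := n + 1), Fin.cons_zero, Fin.cons_succ]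
      rw [← expect_const (additiveShares k (y' 0)) (n * ENNReal.ofReal η), ← expect_add]
      refine expect_mono fun u => ?_
      exact ih hz' (fun s => F (toMultiset u + s)) fun s => hF _
    calc _ ≤ _ := add_le_add_left h2 _
      _ = _ := by push_cast; ring

end Shares

/-! ### Discrete Laplace noise. -/

section Noise

variable {α : ℝ} (h0 : 0 < α) (h1 : α < 1)

/-- The expectation of `g (A + b - c)` for independent geometric variables `b` and `c`. -/
def noisyExpect (g : ℤ → ℝ≥0∞) (A : ℤ) : ℝ≥0∞ :=
  expect (geometric h0 h1) fun b => expect (geometric h0 h1) fun c => g (A + b - c)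

theorem noisyExpect_mono {g g' : ℤ → ℝ≥0∞} (h : ∀ s, g s ≤ g' s) (A : ℤ) :
    noisyExpect h0 h1 g A ≤ noisyExpect h0 h1 g' A :=
  expect_mono fun _ => expect_mono fun _ => h _

theorem noisyExpect_const_mul (r : ℝ≥0∞) (g : ℤ → ℝ≥0∞) (A : ℤ) :
    noisyExpect h0 h1 (fun s => r * g s) A = r * noisyExpect h0 h1 g A := by
  simp only [noisyExpect, expect_const_mul]

theorem noisyExpect_const (r : ℝ≥0∞) (A : ℤ) : noisyExpect h0 h1 (fun _ => r) A = r := by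
  simp only [noisyExpect, expect_const]

/-- The discrete Laplace mechanism. -/
theorem noisyExpect_le (g : ℤ → ℝ≥0∞) {A A' : ℤ} {p : ℕ} (hA : |A - A'| ≤ p) :
    ENNReal.ofReal (α ^ p) * noisyExpect h0 h1 g A ≤ noisyExpect h0 h1 g A' := by
  obtain ⟨d, hd⟩ := Int.eq_nat_or_neg (A - A')
  obtain ⟨hdp, hcase⟩ : d ≤ p ∧ (A = A' + d ∨ A' = A + d) := by
    rcases hd with hd | hd <;> rw [hd] at hA <;> simp at hA <;> constructor <;> omega
  have hpow : ENNReal.ofReal (α ^ p) ≤ ENNReal.ofReal (α ^ d) :=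
    ENNReal.ofReal_le_ofReal (pow_le_pow_of_le_one h0.le h1.le hdp)
  refine (mul_le_mul_left hpow _).trans ?_
  -- The shift is absorbed by `b` if `A` is the larger centre and by `c` otherwise.
  rcases hcase with rfl | rfl
  · refine le_trans (le_of_eq ?_) (expect_geometric_add_le h0 h1 d _)
    refine congrArg _ (congrArg _ (funext fun b => congrArg _ (funext fun c => congrArg g ?_)))
    push_cast
    ring
  · unfold noisyExpect
    rw [← expect_const_mul]
    refine expect_mono fun b => ?_
    refine le_trans (le_of_eq ?_) (expect_geometric_add_le h0 h1 d _)
    refine congrArg _ (congrArg _ (funext fun c => congrArg g ?_))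
    push_cast
    ring

theorem expect_indep_noise {n : ℕ} [NeZero n] (hn : (0 : ℝ) < 1 / n) (g : ℤ → ℝ≥0∞)
    (a : Fin n → ℤ) :
    (expect (indep fun _ : Fin n => polya (1 / n) α hn h0 h1) fun b =>
      expect (indep fun _ : Fin n => polya (1 / n) α hn h0 h1) fun c =>
        g (∑ i, (a i + (b i : ℤ) - (c i : ℤ)))) = noisyExpect h0 h1 g (∑ i, a i) := by
  unfold noisyExpect
  simp only [← expect_indep_polya_one_div h0 h1 hn, Finset.sum_add_distrib, Finset.sum_sub_distrib,
    Nat.cast_sum]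

end Noise

theorem mem_support_randomizedRounding {x : unitInterval} {p : ℕ} {a : ℤ}
    (ha : a ∈ (randomizedRounding x p).support) : 0 ≤ a ∧ a ≤ p := by
  have hx0 : (0 : ℝ) ≤ x * p := mul_nonneg x.2.1 (Nat.cast_nonneg p)
  have hxp : (x : ℝ) * p ≤ p := mul_le_of_le_one_left (Nat.cast_nonneg p) x.2.2
  have hfl : 0 ≤ ⌊(x : ℝ) * p⌋ := Int.floor_nonneg.2 hx0
  obtain ⟨b, hb, rfl⟩ := (PMF.mem_support_map_iff _ _ _).1 ha
  cases b with
  | false =>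
    simp only [Bool.false_eq_true, if_false, add_zero]
    refine ⟨hfl, ?_⟩
    exact_mod_cast (Int.floor_le _).trans hxp
  | true =>
    simp only [if_true]
    refine ⟨by omega, ?_⟩
    -- Rounding up has positive probability only if `x * p` is not an integer, so the floor is then
    -- below `p`.
    have hf : 0 < Int.fract ((x : ℝ) * p) := by
      simpa [ber, PMF.mem_support_iff] using hb
    have : (⌊(x : ℝ) * p⌋ : ℝ) < p := by
      unfold Int.fract at hf
      linarith
    have : ⌊(x : ℝ) * p⌋ < p := by exact_mod_cast this
    omega

/-! ### Differential privacy. -/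

section Privacy

variable {n k p q : ℕ} [NeZero n] [NeZero k] [NeZero q] {α : ℝ} (h0 : 0 < α) (h1 : α < 1)

/-- The rounded inputs of two neighbouring databases have almost the same noisy sum. -/
theorem expect_rounding_le (g : ℤ → ℝ≥0∞) {x x' : Fin n → unitInterval} {i : Fin n}
    (hx : ∀ j, j ≠ i → x j = x' j) :
    ENNReal.ofReal (α ^ p) * (expect (indep fun i => randomizedRounding (x i) p) fun a =>
        noisyExpect h0 h1 g (∑ i, a i)) ≤
      expect (indep fun i => randomizedRounding (x' i) p) fun a =>
        noisyExpect h0 h1 g (∑ i, a i) := by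
  obtain ⟨m, rfl⟩ := Nat.exists_eq_succ_of_ne_zero (NeZero.ne n)
  rw [expect_indep_insertNth i, expect_indep_insertNth i, ← expect_const_mul]
  -- Party `i` may have any two roundings in `[0, p]`, so these are compared in the worst case; the
  -- other parties have the same roundings on both sides.
  refine expect_le_expect fun b hb c hc => ?_
  rw [← expect_const_mul]
  simp only [hx _ (Fin.succAbove_ne i _)]
  refine expect_mono fun a => ?_
  simp only [Fin.sum_univ_succAbove _ i, Fin.insertNth_apply_same, Fin.insertNth_apply_succAbove]
  have hb' := mem_support_randomizedRounding hb
  have hc' := mem_support_randomizedRounding hc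
  refine noisyExpect_le h0 h1 g ?_
  rw [abs_le]
  constructor <;> omega

omit [NeZero n] in
theorem expect_shares_le_add_ofReal {δ : ℝ} (hδ : 0 ≤ δ)
    (hk : 2 * (q : ℝ) ^ 4 * ((n : ℝ) - 1) ^ 2 ≤ δ ^ 2 * 2 ^ k) (hn : 2 ≤ n)
    {y y' : Fin n → ZMod q} (hy : ∑ i, y i = ∑ i, y' i) (F : Multiset (ZMod q) → ℝ≥0∞)
    (hF : ∀ s, F s ≤ 1) :
    expect (indep fun i => additiveShares k (y i)) (fun v => F (∑ i, toMultiset (v i))) ≤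
      expect (indep fun i => additiveShares k (y' i)) (fun v => F (∑ i, toMultiset (v i))) +
        ENNReal.ofReal δ := by
  obtain ⟨l, rfl⟩ : ∃ l, n = l + 1 := ⟨n - 1, by omega⟩
  have hl : (0 : ℝ) < l := Nat.cast_pos.2 (by omega)
  rw [Nat.cast_succ, add_sub_cancel_right] at hk
  have h := expect_shares_le (k := k) (η := δ / l) (by positivity) (by
    rwa [div_pow, div_mul_eq_mul_div, le_div_iff₀ (by positivity)]) l hy F hF
  rwa [← ENNReal.ofReal_natCast l, ← ENNReal.ofReal_mul hl.le, mul_div_cancel₀ _ hl.ne'] at h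

/-- The expectation of a function of the noisy rounded inputs. -/
def expectNoisyInputs (p : ℕ) (x : Fin n → unitInterval) (V : (Fin n → ZMod q) → ℝ≥0∞) : ℝ≥0∞ :=
  have hn : (0 : ℝ) < 1 / n := one_div_pos.2 (Nat.cast_pos.2 (NeZero.pos n))
  expect (indep fun i => randomizedRounding (x i) p) fun a =>
    expect (indep fun _ : Fin n => polya (1 / n) α hn h0 h1) fun b =>
      expect (indep fun _ : Fin n => polya (1 / n) α hn h0 h1) fun c =>
        V fun i => ((a i + (b i : ℤ) - (c i : ℤ) : ℤ) : ZMod q)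

omit [NeZero q] in
theorem expectNoisyInputs_le_add {V V' : (Fin n → ZMod q) → ℝ≥0∞} {M : ℝ≥0∞}
    (h : ∀ y, V y ≤ V' y + M) (x : Fin n → unitInterval) :
    expectNoisyInputs h0 h1 p x V ≤ expectNoisyInputs h0 h1 p x V' + M := by
  unfold expectNoisyInputs
  refine (expect_mono fun a => expect_mono fun b => expect_mono fun c => h _).trans (le_of_eq ?_)
  simp only [expect_add, expect_const]

omit [NeZero q] in
theorem expectNoisyInputs_sum (x : Fin n → unitInterval) (m : ZMod q → ℝ≥0∞) :
    expectNoisyInputs h0 h1 p x (fun y => m (∑ i, y i)) =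
      expect (indep fun i => randomizedRounding (x i) p) fun a =>
        noisyExpect h0 h1 (fun s => m s) (∑ i, a i) := by
  change expect _ _ = expect _ _
  refine congrArg _ (funext fun a => ?_)
  rw [← expect_indep_noise h0 h1 (one_div_pos.2 (Nat.cast_pos.2 (NeZero.pos n)))]
  simp only [Int.cast_sum]

theorem expect_view_eq {O : Type} (P : Protocol n unitInterval (ZMod q) O) [NeZero P.k]
    (hP : P.localRandomizer = localRandomizer n α h0 h1 P.k p q) (x : Fin n → unitInterval)
    (F : Multiset (ZMod q) → ℝ≥0∞) :
    expect (P.view x) (fun v => F (toMultiset v)) = expectNoisyInputs h0 h1 p x fun y =>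
      expect (indep fun i => additiveShares P.k (y i)) fun v => F (∑ i, toMultiset (v i)) := by
  rw [P.expect_view x F, hP, expect_indep_localRandomizer h0 h1 P.k p q]
  rfl

theorem isDP_of_localRandomizer_eq {O : Type} (P : Protocol n unitInterval (ZMod q) O)
    [NeZero P.k] (hP : P.localRandomizer = localRandomizer n α h0 h1 P.k p q) {ε δ : ℝ}
    (hε : Real.exp (-ε) ≤ α ^ p) (hδ : 0 ≤ δ)
    (hk : 2 * (q : ℝ) ^ 4 * ((n : ℝ) - 1) ^ 2 ≤ δ ^ 2 * 2 ^ P.k) (hn2 : 2 ≤ n) :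
    P.IsDP ε δ := by
  intro x x' i hx T
  have hF1 : ∀ s, T.indicator (1 : Multiset (ZMod q) → ℝ≥0∞) s ≤ 1 := fun s =>
    Set.indicator_le_self' (by simp) s
  simp only [toOuterMeasure_eq_expect, expect_map]
  rw [expect_view_eq h0 h1 P hP, expect_view_eq h0 h1 P hP]
  generalize T.indicator (1 : Multiset (ZMod q) → ℝ≥0∞) = F at hF1
  obtain ⟨V, hV⟩ : ∃ V : (Fin n → ZMod q) → ℝ≥0∞, V = fun y =>
    expect (indep fun i => additiveShares P.k (y i)) fun v => F (∑ i, toMultiset (v i)) := ⟨_, rfl⟩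
  have hshares : ∀ y y' : Fin n → ZMod q, ∑ i, y i = ∑ i, y' i →
      V y ≤ V y' + ENNReal.ofReal δ := fun y y' hy => by
    rw [hV]
    exact expect_shares_le_add_ofReal hδ hk hn2 hy F hF1
  rw [← hV]
  -- `m` is the least acceptance probability given the sum. It lies below `V` and within `δ` of it,
  -- so passing from `V` to `m` for `x` costs `δ` once, and returning from `m` to `V` for `x'` is
  -- free; `δ` is never multiplied by `exp ε`.
  set m : ZMod q → ℝ≥0∞ := fun s => ⨅ (y : Fin n → ZMod q) (_ : ∑ i, y i = s), V y with hm
  have hupper := expectNoisyInputs_le_add h0 h1 (p := p) (V := V) (V' := fun y => m (∑ i, y i))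
    (M := ENNReal.ofReal δ) (fun y => by
      rw [← tsub_le_iff_right]
      refine le_iInf₂ fun y' hy' => ?_
      rw [tsub_le_iff_right]
      exact hshares y y' hy'.symm) x
  have hlower := expectNoisyInputs_le_add h0 h1 (p := p) (V := fun y => m (∑ i, y i)) (V' := V)
    (M := 0) (fun y => by
      rw [add_zero]
      exact iInf₂_le (f := fun y' (_ : ∑ i, y' i = ∑ i, y i) => V y') y rfl) x'
  rw [expectNoisyInputs_sum, add_zero] at hlower
  rw [expectNoisyInputs_sum] at hupper
  refine hupper.trans (add_le_add_left (le_trans ?_ (mul_le_mul_right hlower _)) _)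
  refine le_trans ?_ (mul_le_mul_right (expect_rounding_le h0 h1 _ hx) _)
  rw [← mul_assoc, ← ENNReal.ofReal_mul (Real.exp_pos _).le]
  refine le_mul_of_one_le_left zero_le ?_
  rw [ENNReal.one_le_ofReal]
  calc (1 : ℝ) = Real.exp ε * Real.exp (-ε) := by rw [← Real.exp_add]; simp
    _ ≤ _ := mul_le_mul_of_nonneg_left hε (Real.exp_pos _).le

end Privacy

/-! ### The choice of parameters. -/

section Parameters

variable (n : ℕ) [NeZero n]

theorem noiseParam_pow_precision (ε : ℝ) : noiseParam n ε ^ precision n = Real.exp (-ε) := by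
  have h : (precision n : ℝ) ≠ 0 := by exact_mod_cast (precision_pos n).ne'
  rw [noiseParam, ← Real.exp_nat_mul]
  congr 1
  field_simp

theorem le_two_pow_ceil_logb {t : ℝ} (ht : 0 < t) : t ≤ 2 ^ ⌈Real.logb 2 t⌉₊ := by
  rw [← Real.rpow_natCast, ← Real.logb_le_iff_le_rpow one_lt_two ht]
  exact Nat.le_ceil _

/-- The three factors on the left match the three summands of `numMessages`. Privacy needs only `2 *
q ^ 4` in place of `4 * q ^ 5`. -/
theorem le_two_pow_numMessages {δ : ℝ} (hδ : 0 < δ) (hn : 2 ≤ n) :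
    4 * (groupOrder n : ℝ) ^ 5 * (((n : ℝ) - 1) / δ) ^ 2 ≤ 2 ^ numMessages n δ := by
  have hn1 : (0 : ℝ) < (n : ℝ) - 1 := by
    have : (2 : ℝ) ≤ n := by exact_mod_cast hn
    linarith
  have hq : (0 : ℝ) < groupOrder n := by exact_mod_cast NeZero.pos (groupOrder n)
  have e : Real.logb 2 (1 / δ) + Real.logb 2 ((n : ℝ) - 1) = Real.logb 2 (((n : ℝ) - 1) / δ) := by
    rw [← Real.logb_mul (by positivity) hn1.ne']
    congr 1
    ring
  rw [numMessages, e, pow_add, pow_add, mul_comm 5, mul_comm 2, pow_mul, pow_mul]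
  have h1 := le_two_pow_ceil_logb hq
  have h2 := le_two_pow_ceil_logb (div_pos hn1 hδ)
  have h3 : 0 < ((n : ℝ) - 1) / δ := by positivity
  norm_num only
  gcongr

theorem summationProtocol_isDP {ε δ : ℝ} (hε : 0 < ε) (hδ : 0 < δ) (hn : 2 ≤ n) :
    (summationProtocol n ε δ hε).IsDP ε δ := by
  have : NeZero (summationProtocol n ε δ hε).k :=
    inferInstanceAs (NeZero (numMessages n δ))
  refine isDP_of_localRandomizer_eq (Real.exp_pos _) (noiseParam_lt_one n hε)
    (p := precision n) _ rfl (noiseParam_pow_precision n ε).ge hδ.le ?_ hn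
  change _ ≤ δ ^ 2 * 2 ^ numMessages n δ
  have hq : (1 : ℝ) ≤ groupOrder n := by exact_mod_cast NeZero.one_le
  calc 2 * (groupOrder n : ℝ) ^ 4 * ((n : ℝ) - 1) ^ 2
      ≤ 4 * (groupOrder n : ℝ) ^ 5 * ((n : ℝ) - 1) ^ 2 := by
        gcongr
        · norm_num
        · norm_num
    _ = δ ^ 2 * (4 * (groupOrder n : ℝ) ^ 5 * (((n : ℝ) - 1) / δ) ^ 2) := by
        field_simp
    _ ≤ _ := by
        gcongr
        exact le_two_pow_numMessages n hδ hn

end Parameters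

/-! ### Second moments of noise and rounding. -/

section Moments

variable {α : ℝ} (h0 : 0 < α) (h1 : α < 1)

/-- The quadratic is treated as a whole, since `ENNReal.ofReal` truncates negative terms. The series
are summed through `k ^ 2 = 2 * (k + 2).choose 2 - 3 * k - 2`. -/
theorem expect_geometric_quadratic (u v w : ℝ) (h : ∀ k : ℕ, 0 ≤ u + v * k + w * (k : ℝ) ^ 2) :
    expect (geometric h0 h1) (fun k => ENNReal.ofReal (u + v * k + w * (k : ℝ) ^ 2)) =
      ENNReal.ofReal (u + v * (α / (1 - α)) + w * (α * (1 + α) / (1 - α) ^ 2)) := by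
  have hα : ‖α‖ < 1 := by rw [Real.norm_eq_abs, abs_of_pos h0]; exact h1
  have hne : 1 - α ≠ 0 := by linarith
  have hs0 := hasSum_geometric_of_norm_lt_one hα
  have hs1 := hasSum_coe_mul_geometric_of_norm_lt_one hα
  have hs2 := hasSum_choose_mul_geometric_of_norm_lt_one 2 hα
  have hs : HasSum (fun k : ℕ => α ^ k * (1 - α) * (u + v * k + w * (k : ℝ) ^ 2))
      (u + v * (α / (1 - α)) + w * (α * (1 + α) / (1 - α) ^ 2)) := by
    have hsum := ((hs0.mul_left (u - 2 * w)).add ((hs1.mul_left (v - 3 * w)).add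
      (hs2.mul_left (2 * w)))).mul_right (1 - α)
    have hfun : ∀ k : ℕ, α ^ k * (1 - α) * (u + v * k + w * (k : ℝ) ^ 2) =
        ((u - 2 * w) * α ^ k + ((v - 3 * w) * (k * α ^ k) +
          2 * w * ((k + 2).choose 2 * α ^ k))) * (1 - α) := by
      intro k
      rw [Nat.cast_choose_two]
      push_cast
      ring
    simp only [hfun]
    rw [show u + v * (α / (1 - α)) + w * (α * (1 + α) / (1 - α) ^ 2) =
      ((u - 2 * w) * (1 - α)⁻¹ + ((v - 3 * w) * (α / (1 - α) ^ 2) +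
        2 * w * (1 / (1 - α) ^ (2 + 1)))) * (1 - α) by field_simp; ring]
    exact hsum
  unfold expect
  simp only [geometric_apply]
  have hp : ∀ k : ℕ, 0 ≤ α ^ k * (1 - α) := fun k => mul_nonneg (by positivity) (by linarith)
  simp only [← ENNReal.ofReal_mul (hp _)]
  rw [← ENNReal.ofReal_tsum_of_nonneg (fun k => mul_nonneg (hp k) (h k)) hs.summable, hs.tsum_eq]

/-- The discrete Laplace noise is centered and has variance `2 α / (1 - α) ^ 2`. -/
theorem noisyExpect_sq (t : ℝ) (A : ℤ) :
    noisyExpect h0 h1 (fun s => ENNReal.ofReal ((s - t) ^ 2)) A =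
      ENNReal.ofReal ((A - t) ^ 2 + 2 * α / (1 - α) ^ 2) := by
  have hne : 1 - α ≠ 0 := by linarith
  have hinner : ∀ b : ℕ, expect (geometric h0 h1)
      (fun c => ENNReal.ofReal ((((A + b - c : ℤ) : ℝ) - t) ^ 2)) =
      ENNReal.ofReal (((A - t) ^ 2 - 2 * (A - t) * (α / (1 - α)) + α * (1 + α) / (1 - α) ^ 2) +
        (2 * (A - t) - 2 * (α / (1 - α))) * b + 1 * (b : ℝ) ^ 2) := by
    intro b
    have h := expect_geometric_quadratic h0 h1 ((A + b - t) ^ 2) (-2 * (A + b - t)) 1 fun k => by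
      nlinarith [sq_nonneg ((A : ℝ) + b - t - k)]
    rw [show ((A - t) ^ 2 - 2 * (A - t) * (α / (1 - α)) + α * (1 + α) / (1 - α) ^ 2) +
        (2 * (A - t) - 2 * (α / (1 - α))) * b + 1 * (b : ℝ) ^ 2 = (A + b - t) ^ 2 +
        -2 * (A + b - t) * (α / (1 - α)) + 1 * (α * (1 + α) / (1 - α) ^ 2) by ring, ← h]
    refine congrArg _ (funext fun c => congrArg _ ?_)
    push_cast
    ring
  unfold noisyExpect
  simp only [hinner]
  rw [expect_geometric_quadratic]
  · congr 1
    field_simp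
    ring
  · intro b
    -- Squared bias plus variance of `c`; this makes the nonnegativity visible.
    have e : (A - t) ^ 2 - 2 * (A - t) * (α / (1 - α)) + α * (1 + α) / (1 - α) ^ 2 +
        (2 * (A - t) - 2 * (α / (1 - α))) * b + 1 * (b : ℝ) ^ 2 =
        (A - t + b - α / (1 - α)) ^ 2 + α / (1 - α) ^ 2 := by
      field_simp
      ring
    rw [e]
    positivity

theorem expect_ber (t : ℝ) (ht0 : 0 ≤ t) (ht1 : t ≤ 1) (f : Bool → ℝ≥0∞) :
    expect (ber t ht0 ht1) f = ENNReal.ofReal t * f true + ENNReal.ofReal (1 - t) * f false := by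
  simp [expect, ber, tsum_fintype]

/-- The variance of randomized rounding. -/
def roundingVariance (x : ℝ) (p : ℕ) : ℝ := Int.fract (x * p) * (1 - Int.fract (x * p))

theorem roundingVariance_nonneg (x : ℝ) (p : ℕ) : 0 ≤ roundingVariance x p :=
  mul_nonneg (Int.fract_nonneg _) (sub_nonneg.2 (Int.fract_lt_one _).le)

theorem roundingVariance_le (x : ℝ) (p : ℕ) : roundingVariance x p ≤ 1 / 4 := by
  unfold roundingVariance
  nlinarith [sq_nonneg (Int.fract (x * p) - 1 / 2)]

/-- Rounding is unbiased, so only its variance is added. The shape "square plus constant" is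
preserved, so the parties can be treated one by one. -/
theorem expect_rounding_sq (x : ℝ) (p : ℕ) (s w : ℝ) (hw : 0 ≤ w) :
    expect (randomizedRounding x p) (fun a => ENNReal.ofReal ((s + a) ^ 2 + w)) =
      ENNReal.ofReal ((s + x * p) ^ 2 + (roundingVariance x p + w)) := by
  have hf0 := Int.fract_nonneg (x * p)
  have hf1 := sub_nonneg.2 (Int.fract_lt_one (x * p)).le
  rw [randomizedRounding, expect_map, expect_ber, ← ENNReal.ofReal_mul hf0,
    ← ENNReal.ofReal_mul hf1, ← ENNReal.ofReal_add (by positivity) (by positivity)]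
  congr 1
  have e : (⌊x * p⌋ : ℝ) = x * p - Int.fract (x * p) := by
    rw [Int.self_sub_fract]
  simp only [if_true, Bool.false_eq_true, if_false, roundingVariance]
  push_cast
  rw [e]
  ring

theorem expect_indep_rounding_sq {n : ℕ} (x : Fin n → ℝ) (p : ℕ) (s w : ℝ) (hw : 0 ≤ w) :
    expect (indep fun i => randomizedRounding (x i) p)
        (fun a => ENNReal.ofReal ((s + (∑ i, a i : ℤ)) ^ 2 + w)) =
      ENNReal.ofReal ((s + ∑ i, x i * p) ^ 2 + (∑ i, roundingVariance (x i) p + w)) := by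
  induction n generalizing s w with
  | zero => simp [expect_indep_zero]
  | succ n ih =>
    have hsum : 0 ≤ ∑ i : Fin n, roundingVariance (x i.succ) p :=
      Finset.sum_nonneg fun i _ => roundingVariance_nonneg _ _
    rw [expect_indep_cons]
    have h : ∀ a : ℤ, expect (indep fun i : Fin n => randomizedRounding (x i.succ) p)
        (fun b => ENNReal.ofReal ((s + (∑ i, (Fin.cons a b : Fin (n + 1) → ℤ) i : ℤ)) ^ 2 + w)) =
        ENNReal.ofReal (((s + ∑ i : Fin n, x i.succ * p) + a) ^ 2 +
          (∑ i : Fin n, roundingVariance (x i.succ) p + w)) := by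
      intro a
      rw [show s + ∑ i : Fin n, x i.succ * p + a = (s + a) + ∑ i : Fin n, x i.succ * p by ring,
        ← ih (fun i => x i.succ) (s + a) w hw]
      refine congrArg _ (funext fun b => ?_)
      rw [Fin.sum_univ_succ]
      simp only [Fin.cons_zero, Fin.cons_succ]
      push_cast
      rw [add_assoc]
    simp only [h]
    rw [expect_rounding_sq _ _ _ _ (by positivity), Fin.sum_univ_succ (fun i => x i * (p : ℝ)),
      Fin.sum_univ_succ (fun i => roundingVariance (x i) p)]
    congr 1
    ring

end Moments

/-! ### Decoding and wrap-around. -/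

section Decode

/-- The analyzer as a function of the sum of all messages. -/
def decode (n p q : ℕ) (z : ZMod q) : ℝ :=
  if ((n * p + q : ℕ) : ℝ) / 2 < (z.val : ℝ) then ((z.val : ℝ) - q) / p else (z.val : ℝ) / p

variable {n p q : ℕ}

/-- Decoding is correct unless there is an overflow. -/
theorem decode_intCast (hn : 0 < n) (hp : 0 < p) (hq : q = 2 * n * p) {s : ℤ}
    (hs : -((n * p : ℕ) : ℤ) < 2 * s) (hs' : 2 * s ≤ 3 * ((n * p : ℕ) : ℤ)) :
    decode n p q (s : ZMod q) = s / p := by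
  have hN : 0 < n * p := Nat.mul_pos hn hp
  have hqN : q = 2 * (n * p) := by rw [hq, mul_assoc]
  have : NeZero q := ⟨by omega⟩
  have hval := ZMod.val_intCast (n := q) s
  unfold decode
  generalize (s : ZMod q).val = v at hval
  -- The threshold is `3 * n * p / 2`; nonnegative `s` is its own representative, at most the
  -- threshold, while negative `s` is represented by `s + q`, above it.
  rcases le_or_gt 0 s with h | h
  · rw [Int.emod_eq_of_lt h (by omega)] at hval
    have h2 : ¬((n * p + q : ℕ) : ℝ) / 2 < (v : ℝ) := by
      rw [not_lt, le_div_iff₀ two_pos]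
      have : v * 2 ≤ n * p + q := by omega
      exact_mod_cast this
    rw [if_neg h2, ← hval, Int.cast_natCast]
  · rw [← Int.add_emod_right, Int.emod_eq_of_lt (by omega) (by omega)] at hval
    have h2 : ((n * p + q : ℕ) : ℝ) / 2 < (v : ℝ) := by
      rw [div_lt_iff₀ two_pos]
      have : n * p + q < v * 2 := by omega
      exact_mod_cast this
    rw [if_pos h2, show s = (v : ℤ) - q by omega]
    push_cast
    rfl

theorem decode_sub_sq_le (hn : 0 < n) (hp : 0 < p) (hq : q = 2 * n * p) (z : ZMod q) {X : ℝ}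
    (hX0 : 0 ≤ X) (hXn : X ≤ n) : (decode n p q z - X) ^ 2 ≤ 4 * (n : ℝ) ^ 2 := by
  have hp' : (0 : ℝ) < p := by exact_mod_cast hp
  have hN : 0 < n * p := Nat.mul_pos hn hp
  have hqN : q = 2 * (n * p) := by rw [hq, mul_assoc]
  have : NeZero q := ⟨by omega⟩
  have hqr : (q : ℝ) = 2 * (n * p) := by exact_mod_cast hqN
  have hv : (z.val : ℝ) < q := by exact_mod_cast ZMod.val_lt z
  have hv0 : (0 : ℝ) ≤ z.val := Nat.cast_nonneg _
  have hnr : (0 : ℝ) < n := by exact_mod_cast hn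
  have hdec : -(n : ℝ) ≤ decode n p q z ∧ decode n p q z ≤ 2 * n := by
    unfold decode
    push_cast
    split_ifs with h
    · rw [le_div_iff₀ hp', div_le_iff₀ hp']
      constructor <;> nlinarith
    · rw [le_div_iff₀ hp', div_le_iff₀ hp']
      constructor <;> nlinarith
  nlinarith [hdec.1, hdec.2]

end Decode

/-! ### Comparison with the error without wrap-around. -/

section Error

variable {n p q : ℕ} {α : ℝ} (h0 : 0 < α) (h1 : α < 1)

theorem noisyExpect_ideal (hp : 0 < p) (X : ℝ) (A : ℤ) :
    noisyExpect h0 h1 (fun s => ENNReal.ofReal ((s / p - X) ^ 2)) A =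
      ENNReal.ofReal (((A - p * X) ^ 2 + 2 * α / (1 - α) ^ 2) / (p : ℝ) ^ 2) := by
  have hp' : (0 : ℝ) < p := by exact_mod_cast hp
  have e : ∀ s : ℤ, ENNReal.ofReal (((s : ℝ) / p - X) ^ 2) =
      ENNReal.ofReal (1 / (p : ℝ) ^ 2) * ENNReal.ofReal ((s - p * X) ^ 2) := by
    intro s
    rw [← ENNReal.ofReal_mul (by positivity)]
    congr 1
    field_simp
  simp only [e]
  rw [noisyExpect_const_mul, noisyExpect_sq, ← ENNReal.ofReal_mul (by positivity)]
  congr 1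
  ring

/-- The mean squared error without overflow. -/
theorem expect_rounding_ideal (hp : 0 < p) (x : Fin n → unitInterval) :
    (expect (indep fun i => randomizedRounding (x i) p) fun a =>
      noisyExpect h0 h1 (fun s => ENNReal.ofReal ((s / p - ∑ i, (x i : ℝ)) ^ 2)) (∑ i, a i)) =
      ENNReal.ofReal ((∑ i, roundingVariance (x i) p + 2 * α / (1 - α) ^ 2) / (p : ℝ) ^ 2) := by
  have hp' : (0 : ℝ) < p := by exact_mod_cast hp
  have h1' : 0 < 1 - α := by linarith
  simp only [noisyExpect_ideal h0 h1 hp, div_eq_mul_inv _ ((p : ℝ) ^ 2)]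
  have e : ∀ A : ℤ, ENNReal.ofReal ((((A : ℝ) - p * ∑ i, (x i : ℝ)) ^ 2 +
      2 * α * ((1 - α) ^ 2)⁻¹) * ((p : ℝ) ^ 2)⁻¹) = ENNReal.ofReal ((p : ℝ) ^ 2)⁻¹ *
      ENNReal.ofReal ((-(p * ∑ i, (x i : ℝ)) + A) ^ 2 + 2 * α * ((1 - α) ^ 2)⁻¹) := by
    intro A
    rw [← ENNReal.ofReal_mul (by positivity)]
    congr 1
    ring
  simp only [div_eq_mul_inv, e]
  rw [expect_const_mul, expect_indep_rounding_sq (fun i => (x i : ℝ)) _ _ _ (by positivity),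
    ← ENNReal.ofReal_mul (by positivity), ← Finset.sum_mul]
  congr 1
  ring

/-- The event that the noise is large is unlikely. -/
theorem expect_expect_large_le (m : ℕ) (g : ℕ → ℕ → ℝ≥0∞) (M : ℝ≥0∞)
    (hb : (expect (geometric h0 h1) fun b => expect (geometric h0 h1) fun c => g (b + m) c) ≤ M)
    (hc : (expect (geometric h0 h1) fun b => expect (geometric h0 h1) fun c => g b (c + m)) ≤ M) :
    (expect (geometric h0 h1) fun b => expect (geometric h0 h1) fun c =>
      (if m ≤ b then g b c else 0) + if m ≤ c then g b c else 0) ≤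
      2 * (ENNReal.ofReal (α ^ m) * M) := by
  simp only [expect_add, ← expect_geometric_add, expect_const_mul]
  rw [two_mul]
  refine add_le_add ?_ (mul_le_mul_right hc _)
  refine le_trans (le_of_eq ?_) (mul_le_mul_right hb _)
  rw [expect_geometric_add h0 h1 m fun b => expect (geometric h0 h1) (g b)]
  refine congrArg _ (funext fun b => ?_)
  split_ifs
  · rfl
  · exact expect_const _ _

/-- The two errors agree unless `b` or `c` is large. By memorylessness, each such event contributes
`α ^ m` times an error with centre shifted by `m`. -/
theorem noisyExpect_decode_close (hn : 0 < n) (hp : 0 < p) (hq : q = 2 * n * p) {X : ℝ}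
    (hX0 : 0 ≤ X) (hXn : X ≤ n) {A : ℤ} (hA0 : 0 ≤ A) (hA : A ≤ (n * p : ℕ)) :
    noisyExpect h0 h1 (fun s => ENNReal.ofReal ((decode n p q (s : ZMod q) - X) ^ 2)) A ≤
      noisyExpect h0 h1 (fun s => ENNReal.ofReal ((s / p - X) ^ 2)) A +
        2 * (ENNReal.ofReal (α ^ ((n * p + 1) / 2)) *
          ENNReal.ofReal (4 * (n : ℝ) ^ 2 + 2 * α / (1 - α) ^ 2 / (p : ℝ) ^ 2)) ∧
    noisyExpect h0 h1 (fun s => ENNReal.ofReal ((s / p - X) ^ 2)) A ≤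
      noisyExpect h0 h1 (fun s => ENNReal.ofReal ((decode n p q (s : ZMod q) - X) ^ 2)) A +
        2 * (ENNReal.ofReal (α ^ ((n * p + 1) / 2)) *
          ENNReal.ofReal (4 * (n : ℝ) ^ 2 + 2 * α / (1 - α) ^ 2 / (p : ℝ) ^ 2)) := by
  have hp' : (0 : ℝ) < p := by exact_mod_cast hp
  have h1' : 0 < 1 - α := by linarith
  have hN : 0 < n * p := Nat.mul_pos hn hp
  -- This is `n * p / 2` rounded up: if `b, c < m`, then `A + b - c` stays in the range where
  -- decoding is correct.
  set m := (n * p + 1) / 2 with hm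
  set g₁ : ℤ → ℝ≥0∞ := fun s => ENNReal.ofReal ((decode n p q (s : ZMod q) - X) ^ 2) with hg₁
  set g₀ : ℤ → ℝ≥0∞ := fun s => ENNReal.ofReal ((s / p - X) ^ 2) with hg₀
  set M : ℝ := 4 * (n : ℝ) ^ 2 + 2 * α / (1 - α) ^ 2 / (p : ℝ) ^ 2 with hM
  have hM1 : ∀ s, g₁ s ≤ ENNReal.ofReal M := fun s => ENNReal.ofReal_le_ofReal <|
    (decode_sub_sq_le hn hp hq _ hX0 hXn).trans (le_add_of_nonneg_right (by positivity))
  -- The undecoded error is unbounded, but its expectation is controlled: the shifted centre lies in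
  -- `[-n p, 2 n p]`, within `2 n p` of `p * X`.
  have hM0 : ∀ A' : ℤ, |A' - A| ≤ m → noisyExpect h0 h1 g₀ A' ≤ ENNReal.ofReal M := by
    intro A' hA'
    rw [noisyExpect_ideal h0 h1 hp]
    refine ENNReal.ofReal_le_ofReal ?_
    rw [hM, add_div]
    refine add_le_add_left ?_ _
    rw [div_le_iff₀ (by positivity)]
    have hb : -((n * p : ℕ) : ℤ) ≤ A' ∧ A' ≤ 2 * (n * p : ℕ) := by
      rw [abs_le] at hA'
      omega
    have hb1 : -((n : ℝ) * p) ≤ A' := by exact_mod_cast hb.1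
    have hb2 : (A' : ℝ) ≤ 2 * (n * p) := by exact_mod_cast hb.2
    have hX1 : 0 ≤ p * X := by positivity
    have hX2 : p * X ≤ n * p := by nlinarith
    nlinarith
  have hgood : ∀ b c : ℕ, ¬m ≤ b → ¬m ≤ c → g₁ (A + b - c) = g₀ (A + b - c) := by
    intro b c hb hc
    simp only [hg₁, hg₀]
    rw [decode_intCast hn hp hq (by omega) (by omega)]
  have hsplit : ∀ g g' : ℤ → ℝ≥0∞, (∀ b c : ℕ, ¬m ≤ b → ¬m ≤ c → g (A + b - c) ≤ g' (A + b - c)) →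
      noisyExpect h0 h1 g (A + m) ≤ ENNReal.ofReal M →
      noisyExpect h0 h1 g (A - m) ≤ ENNReal.ofReal M →
      noisyExpect h0 h1 g A ≤ noisyExpect h0 h1 g' A +
        2 * (ENNReal.ofReal (α ^ m) * ENNReal.ofReal M) := by
    intro g g' hgg hb hc
    refine le_trans ?_ (add_le_add_right (expect_expect_large_le h0 h1 m
      (fun b c => g (A + b - c)) (ENNReal.ofReal M) ?_ ?_) _)
    · unfold noisyExpect
      simp only [← expect_add]
      refine expect_mono fun b => expect_mono fun c => ?_
      by_cases hb : m ≤ b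
      · rw [if_pos hb]
        exact le_add_left (le_add_right le_rfl)
      · by_cases hc : m ≤ c
        · rw [if_pos hc]
          exact le_add_left (le_add_left le_rfl)
        · exact le_add_right (hgg b c hb hc)
    · refine le_trans (le_of_eq ?_) hb
      refine congrArg _ (funext fun b => congrArg _ (funext fun c => congrArg g ?_))
      push_cast
      ring
    · refine le_trans (le_of_eq ?_) hc
      refine congrArg _ (funext fun b => congrArg _ (funext fun c => congrArg g ?_))
      push_cast
      ring
  have hle : ∀ A', noisyExpect h0 h1 g₁ A' ≤ ENNReal.ofReal M := fun A' =>
    (noisyExpect_mono h0 h1 hM1 A').trans (noisyExpect_const h0 h1 _ A').le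
  exact ⟨hsplit g₁ g₀ (fun b c hb hc => (hgood b c hb hc).le) (hle _) (hle _),
    hsplit g₀ g₁ (fun b c hb hc => (hgood b c hb hc).ge) (hM0 _ (by simp)) (hM0 _ (by simp))⟩

end Error

/-! ### The error of the summation protocol. -/

section Protocol

variable (n : ℕ) [NeZero n] {ε δ : ℝ} (hε : 0 < ε)

theorem noiseParam_pos (n : ℕ) (ε : ℝ) : 0 < noiseParam n ε := Real.exp_pos _

omit [NeZero n] in
theorem expect_shares_sum {q k : ℕ} [NeZero q] [NeZero k] (y : Fin n → ZMod q)
    (h : ZMod q → ℝ≥0∞) :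
    expect (indep fun i => additiveShares k (y i))
      (fun v => h (∑ i, toMultiset (v i)).sum) = h (∑ i, y i) := by
  rw [← expect_const (indep fun i => additiveShares k (y i)) (h (∑ i, y i))]
  refine expect_congr fun v hv => congrArg h ?_
  rw [← Multiset.coe_sumAddMonoidHom, map_sum]
  exact Finset.sum_congr rfl fun i _ =>
    sum_eq_of_mem_support_additiveShares (mem_support_indep hv i)

theorem mse_eq (x : Fin n → unitInterval) :
    (summationProtocol n ε δ hε).mse x =
      expect (indep fun i => randomizedRounding (x i) (precision n)) fun a =>
        noisyExpect (noiseParam_pos n ε) (noiseParam_lt_one n hε) (fun s => ENNReal.ofReal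
          ((decode n (precision n) (groupOrder n) (s : ZMod (groupOrder n)) -
            ∑ i, (x i : ℝ)) ^ 2)) (∑ i, a i) := by
  have : NeZero (summationProtocol n ε δ hε).k := inferInstanceAs (NeZero (numMessages n δ))
  rw [← expectNoisyInputs_sum _ _ _ fun z => ENNReal.ofReal
    ((decode n (precision n) (groupOrder n) z - ∑ i, (x i : ℝ)) ^ 2)]
  have h := expect_view_eq (noiseParam_pos n ε) (noiseParam_lt_one n hε)
    (summationProtocol n ε δ hε) rfl x fun m => ENNReal.ofReal
      ((decode n (precision n) (groupOrder n) m.sum - ∑ i, (x i : ℝ)) ^ 2)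
  refine (expect_map _ _ _).trans (h.trans (congrArg _ (funext fun y => ?_)))
  exact expect_shares_sum n y fun z => ENNReal.ofReal
    ((decode n (precision n) (groupOrder n) z - ∑ i, (x i : ℝ)) ^ 2)

/-- A bound for the contribution of overflows to the error. -/
def overflowBound (ε : ℝ) : ℝ≥0∞ :=
  2 * (ENNReal.ofReal (noiseParam n ε ^ ((n * precision n + 1) / 2)) *
    ENNReal.ofReal (4 * (n : ℝ) ^ 2 +
      2 * noiseParam n ε / (1 - noiseParam n ε) ^ 2 / (precision n : ℝ) ^ 2))

theorem mse_close (x : Fin n → unitInterval) :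
    (summationProtocol n ε δ hε).mse x ≤ ENNReal.ofReal
      ((∑ i, roundingVariance (x i) (precision n) +
        2 * noiseParam n ε / (1 - noiseParam n ε) ^ 2) / (precision n : ℝ) ^ 2) +
      overflowBound n ε ∧
    ENNReal.ofReal ((∑ i, roundingVariance (x i) (precision n) +
        2 * noiseParam n ε / (1 - noiseParam n ε) ^ 2) / (precision n : ℝ) ^ 2) ≤
      (summationProtocol n ε δ hε).mse x + overflowBound n ε := by
  have hp := precision_pos n
  have hX0 : 0 ≤ ∑ i, (x i : ℝ) := Finset.sum_nonneg fun i _ => (x i).2.1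
  have hXn : ∑ i, (x i : ℝ) ≤ n := by
    simpa using Finset.sum_le_sum fun (i : Fin n) (_ : i ∈ Finset.univ) => (x i).2.2
  have hclose := fun (a : Fin n → ℤ)
      (ha : a ∈ (indep fun i => randomizedRounding (x i) (precision n)).support) =>
    noisyExpect_decode_close (noiseParam_pos n ε) (noiseParam_lt_one n hε)
      (NeZero.pos n) hp (show groupOrder n = 2 * n * precision n from rfl) hX0 hXn
      (A := ∑ i, a i)
      (Finset.sum_nonneg fun i _ => (mem_support_randomizedRounding (mem_support_indep ha i)).1)
      (by
        have := Finset.sum_le_sum fun (i : Fin n) (_ : i ∈ Finset.univ) =>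
          (mem_support_randomizedRounding (mem_support_indep ha i)).2
        simpa using this)
  rw [mse_eq, ← expect_rounding_ideal (noiseParam_pos n ε)
    (noiseParam_lt_one n hε) hp x]
  have hconst := expect_const (indep fun i => randomizedRounding (x i) (precision n))
    (overflowBound n ε)
  rw [← hconst, ← expect_add, ← expect_add]
  exact ⟨expect_mono' fun a ha => (hclose a ha).1, expect_mono' fun a ha => (hclose a ha).2⟩

variable {n}

omit [NeZero n] in
theorem sq_le_precision_sq : (n : ℝ) ≤ (precision n : ℝ) ^ 2 := by
  rw [← Real.sqrt_le_left (Nat.cast_nonneg _)]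
  exact Nat.le_ceil _

include hε in
-- Bernoulli's inequality gives `1 - exp (-ε) = 1 - α ^ p ≤ p * (1 - α)`.
theorem noise_variance_le : 2 * noiseParam n ε / (1 - noiseParam n ε) ^ 2 /
    (precision n : ℝ) ^ 2 ≤ 2 / (1 - Real.exp (-ε)) ^ 2 := by
  have hp : (0 : ℝ) < precision n := by exact_mod_cast precision_pos n
  have h1 := noiseParam_lt_one n hε
  have h0 := noiseParam_pos n ε
  have hb := one_add_mul_sub_le_pow (a := noiseParam n ε) (by linarith) (precision n)
  rw [noiseParam_pow_precision] at hb
  have he : Real.exp (-ε) < 1 := by simpa using hε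
  rw [div_div, ← mul_pow]
  have h2 : 0 < 1 - Real.exp (-ε) := by linarith
  gcongr
  · linarith
  · linarith

include hε in
theorem mseFormula_le :
    mseFormula n ε ≤ 2 / (1 - Real.exp (-ε)) ^ 2 + 1 / 4 := by
  have hp : (0 : ℝ) < precision n := by exact_mod_cast precision_pos n
  unfold mseFormula
  refine add_le_add ?_ ?_
  · rw [mul_comm ((precision n : ℝ) ^ 2), ← div_div]
    exact noise_variance_le hε
  · rw [div_le_div_iff₀ (by positivity) (by norm_num)]
    linarith [sq_le_precision_sq (n := n)]

include hε in
theorem overflowBound_le : overflowBound n ε ≤ ENNReal.ofReal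
    ((8 + 4 / (1 - Real.exp (-ε)) ^ 2) * (n : ℝ) ^ 2 * Real.exp (-ε * n / 2)) := by
  have hp : (0 : ℝ) < precision n := by exact_mod_cast precision_pos n
  have hn : (1 : ℝ) ≤ n := by exact_mod_cast NeZero.one_le
  have hpow : noiseParam n ε ^ ((n * precision n + 1) / 2) ≤ Real.exp (-ε * n / 2) := by
    rw [noiseParam, ← Real.exp_nat_mul, Real.exp_le_exp]
    have h : n * precision n ≤ 2 * ((n * precision n + 1) / 2) := by omega
    have h' : (n : ℝ) * precision n ≤ 2 * ((n * precision n + 1) / 2 : ℕ) := by exact_mod_cast h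
    rw [mul_div_assoc', div_le_div_iff₀ hp two_pos]
    nlinarith
  have hvar := noise_variance_le (n := n) hε
  rw [overflowBound, ← ENNReal.ofReal_mul (pow_nonneg (noiseParam_pos n ε).le _),
    ← ENNReal.ofReal_ofNat 2, ← ENNReal.ofReal_mul (by norm_num)]
  refine ENNReal.ofReal_le_ofReal ?_
  have hD : 0 ≤ 2 / (1 - Real.exp (-ε)) ^ 2 := by positivity
  have hsum : 4 * (n : ℝ) ^ 2 +
      2 * noiseParam n ε / (1 - noiseParam n ε) ^ 2 / (precision n : ℝ) ^ 2 ≤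
      (4 + 2 / (1 - Real.exp (-ε)) ^ 2) * (n : ℝ) ^ 2 := by
    have : (1 : ℝ) ≤ (n : ℝ) ^ 2 := one_le_pow₀ hn
    nlinarith
  calc _ ≤ 2 * (Real.exp (-ε * n / 2) * ((4 + 2 / (1 - Real.exp (-ε)) ^ 2) * (n : ℝ) ^ 2)) := by
        refine mul_le_mul_of_nonneg_left (mul_le_mul hpow hsum ?_ (Real.exp_pos _).le) two_pos.le
        have := noiseParam_pos n ε
        positivity
    _ = _ := by ring

omit [NeZero n] in
include hε in
-- Uses `exp t ≥ t ^ 2 / 2` at `t = ε * n / 2`.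
theorem sq_mul_exp_le : (n : ℝ) ^ 2 * Real.exp (-ε * n / 2) ≤ 8 / ε ^ 2 := by
  have h := Real.quadratic_le_exp_of_nonneg (x := ε * n / 2) (by positivity)
  have h0 : (0 : ℝ) ≤ ε * n / 2 := by positivity
  rw [show -ε * n / 2 = -(ε * n / 2) by ring, Real.exp_neg, ← div_eq_mul_inv,
    div_le_div_iff₀ (Real.exp_pos _) (by positivity)]
  nlinarith

theorem sup_mse_le : (⨆ x, (summationProtocol n ε δ hε).mse x) ≤
    ENNReal.ofReal (mseFormula n ε) + overflowBound n ε := by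
  have hp : (0 : ℝ) < precision n := by exact_mod_cast precision_pos n
  refine iSup_le fun x => (mse_close n hε x).1.trans ?_
  refine add_le_add_left (ENNReal.ofReal_le_ofReal ?_) _
  have h : ∑ i, roundingVariance (x i) (precision n) ≤ n * (1 / 4) := by
    simpa using Finset.sum_le_sum fun (i : Fin n) (_ : i ∈ Finset.univ) =>
      roundingVariance_le (x i) (precision n)
  calc _ ≤ (n * (1 / 4) + 2 * noiseParam n ε / (1 - noiseParam n ε) ^ 2) /
        (precision n : ℝ) ^ 2 := by gcongr
    _ = _ := by
      have : 1 - noiseParam n ε ≠ 0 := by linarith [noiseParam_lt_one n hε]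
      unfold mseFormula
      field_simp
      ring

/-- The input with all entries `1 / (2 p)` gives every party the maximal rounding variance `1 / 4`.
-/
theorem mseFormula_le_sup_mse : ENNReal.ofReal (mseFormula n ε) ≤
    (⨆ x, (summationProtocol n ε δ hε).mse x) + overflowBound n ε := by
  have hp : (1 : ℝ) ≤ precision n := by exact_mod_cast precision_pos n
  have hx : 1 / (2 * (precision n : ℝ)) ∈ unitInterval :=
    ⟨by positivity, by rw [div_le_one (by positivity)]; linarith⟩
  have h := (mse_close (δ := δ) n hε fun _ => ⟨_, hx⟩).2
  refine le_trans (le_of_eq ?_) (h.trans (add_le_add_left (le_iSup _ _) _))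
  have hv : roundingVariance (1 / (2 * (precision n : ℝ))) (precision n) = 1 / 4 := by
    have e : 1 / (2 * (precision n : ℝ)) * precision n = 1 / 2 := by field_simp
    rw [roundingVariance, e, Int.fract_eq_self.2 ⟨by norm_num, by norm_num⟩]
    norm_num
  have : 1 - noiseParam n ε ≠ 0 := by linarith [noiseParam_lt_one n hε]
  simp only [hv, Finset.sum_const, Finset.card_univ, Fintype.card_fin, nsmul_eq_mul]
  unfold mseFormula
  congr 1
  field_simp
  ring

end Protocol

/-! ### Communication. -/

section Communication

theorem bitsPerParty_eq (n : ℕ) [NeZero n] {ε δ : ℝ} (hε : 0 < ε) :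
    (summationProtocol n ε δ hε).bitsPerParty =
      numMessages n δ * ⌈Real.logb 2 (groupOrder n)⌉₊ := by
  have h := Real.natCeil_logb_natCast 2 (groupOrder n)
  rw [Nat.cast_ofNat] at h
  rw [Protocol.bitsPerParty, Nat.card_zmod, h]
  rfl

theorem groupOrder_le_pow {n : ℕ} (hn : 2 ≤ n) : groupOrder n ≤ n ^ 3 := by
  have hp : precision n ≤ n := by
    refine Nat.ceil_le.2 (Real.sqrt_le_iff.2 ⟨Nat.cast_nonneg _, ?_⟩)
    have : (1 : ℝ) ≤ n := by exact_mod_cast (by omega : 1 ≤ n)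
    nlinarith
  calc groupOrder n = 2 * n * precision n := rfl
    _ ≤ n * n * n := by gcongr
    _ = n ^ 3 := by ring

theorem ceil_logb_groupOrder_le {n : ℕ} (hn : 2 ≤ n) :
    (⌈Real.logb 2 (groupOrder n)⌉₊ : ℝ) ≤ 4 * Real.logb 2 n := by
  have : NeZero n := ⟨by omega⟩
  have hn' : (2 : ℝ) ≤ n := by exact_mod_cast hn
  have hL : 1 ≤ Real.logb 2 n := by
    rw [Real.le_logb_iff_rpow_le one_lt_two (by linarith)]
    simpa using hn'
  have hq : (1 : ℝ) ≤ groupOrder n := by exact_mod_cast NeZero.one_le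
  have h1 := Nat.ceil_lt_add_one (Real.logb_nonneg one_lt_two hq)
  have h2 : Real.logb 2 (groupOrder n) ≤ 3 * Real.logb 2 n := by
    rw [show (3 : ℝ) = (3 : ℕ) by norm_num, ← Real.logb_pow]
    refine Real.logb_le_logb_of_le one_lt_two (by linarith) ?_
    exact_mod_cast groupOrder_le_pow hn
  linarith

theorem numMessages_le {n : ℕ} (hn : 2 ≤ n) {δ : ℝ} (hδ : 0 < δ) (hδ1 : δ < 1) :
    (numMessages n δ : ℝ) ≤ (26 + 2 * Real.logb 2 (1 / δ)) * Real.logb 2 n := by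
  have hn' : (2 : ℝ) ≤ n := by exact_mod_cast hn
  have hL : 1 ≤ Real.logb 2 n := by
    rw [Real.le_logb_iff_rpow_le one_lt_two (by linarith)]
    simpa using hn'
  have hD : 0 ≤ Real.logb 2 (1 / δ) :=
    Real.logb_nonneg one_lt_two ((one_le_div hδ).2 hδ1.le)
  have hn1 : 0 ≤ Real.logb 2 ((n : ℝ) - 1) := Real.logb_nonneg one_lt_two (by linarith)
  have h1 := Nat.ceil_lt_add_one (add_nonneg hD hn1)
  have h2 : Real.logb 2 ((n : ℝ) - 1) ≤ Real.logb 2 n :=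
    Real.logb_le_logb_of_le one_lt_two (by linarith) (by linarith)
  have h3 := ceil_logb_groupOrder_le hn
  unfold numMessages
  push_cast
  nlinarith

end Communication

end ShuffleSum

end

theorem mainTheorem1 :
    -- privacy
    (∀ (ε δ : ℝ) (hε : 0 < ε), 0 < δ → δ < 1 → ∀ (n : ℕ) [NeZero n], 2 ≤ n →
      (summationProtocol n ε δ hε).IsDP ε δ) ∧
    -- error
    (∀ (ε : ℝ) (hε : 0 < ε), ∃ A B : ℝ, ∀ δ : ℝ, 0 < δ → δ < 1 →
      ∀ (n : ℕ) [NeZero n], 2 ≤ n →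
        (⨆ x, (summationProtocol n ε δ hε).mse x) ≤ ENNReal.ofReal B ∧
        (⨆ x, (summationProtocol n ε δ hε).mse x) ≤
          ENNReal.ofReal (mseFormula n ε) +
            ENNReal.ofReal (A * (n : ℝ) ^ 2 * Real.exp (-ε * n / 2)) ∧
        ENNReal.ofReal (mseFormula n ε) ≤
          (⨆ x, (summationProtocol n ε δ hε).mse x) +
            ENNReal.ofReal (A * (n : ℝ) ^ 2 * Real.exp (-ε * n / 2))) ∧
    -- communication
    (∀ δ : ℝ, 0 < δ → δ < 1 → ∃ K : ℝ, ∀ (ε : ℝ) (hε : 0 < ε) (n : ℕ) [NeZero n], 2 ≤ n →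
      (summationProtocol n ε δ hε).bitsPerParty =
        numMessages n δ * ⌈Real.logb 2 (groupOrder n)⌉₊ ∧
      ((summationProtocol n ε δ hε).bitsPerParty : ℝ) ≤ K * (Real.log n) ^ 2) := by
  refine ⟨fun ε δ hε hδ _ n _ hn => summationProtocol_isDP n hε hδ hn, fun ε hε => ?_,
    fun δ hδ hδ1 => ?_⟩
  -- `A` is the constant of `overflowBound_le`; `B` adds to the bound of `mseFormula_le` the maximal
  -- overflow `A * (8 / ε ^ 2)`.
  · refine ⟨8 + 4 / (1 - Real.exp (-ε)) ^ 2, 2 / (1 - Real.exp (-ε)) ^ 2 + 1 / 4 +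
      (8 + 4 / (1 - Real.exp (-ε)) ^ 2) * (8 / ε ^ 2), fun δ _ _ n _ _ => ⟨?_, ?_, ?_⟩⟩
    · rw [ENNReal.ofReal_add (by positivity) (by positivity)]
      refine (sup_mse_le hε).trans (add_le_add (ENNReal.ofReal_le_ofReal (mseFormula_le hε))
        ((overflowBound_le hε).trans (ENNReal.ofReal_le_ofReal ?_)))
      rw [mul_assoc]
      exact mul_le_mul_of_nonneg_left (sq_mul_exp_le hε) (by positivity)
    · exact (sup_mse_le hε).trans (add_le_add_right (overflowBound_le hε) _)
    · exact (mseFormula_le_sup_mse hε).trans (add_le_add_right (overflowBound_le hε) _)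
  · refine ⟨(26 + 2 * Real.logb 2 (1 / δ)) * 4 / Real.log 2 ^ 2, fun ε hε n _ hn =>
      ⟨bitsPerParty_eq n hε, ?_⟩⟩
    rw [bitsPerParty_eq, Nat.cast_mul]
    have h1 := numMessages_le hn hδ hδ1
    refine (mul_le_mul h1 (ceil_logb_groupOrder_le hn) (Nat.cast_nonneg _)
      ((Nat.cast_nonneg _).trans h1)).trans (le_of_eq ?_)
    rw [show Real.logb 2 n = Real.log n / Real.log 2 from rfl]
    ring
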